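/- Let $n \geq 3$, and let $S_B^2(\mathfrak{so}(n))$ be the space of algebraic curvature operators on $\mathbb{R}^n$, i.e. of 4-tensors $R$ with $R_{ijkl} = -R_{jikl} = R_{klij}$ and $R_{ijkl} + R_{iklj} + R_{iljk} = 0$. For $R \in S_B^2(\mathfrak{so}(n))$ put (summing over repeated indices $p,q$) \[Q(R)_{ijkl} = R_{ijpq} R_{klpq} + 2 R_{ipkq} R_{jplq} - 2 R_{iplq} R_{jpkq}.\] A set $F \subset S_B^2(\mathfrak{so}(n))$ is called invariant under the Hamilton ODE $\frac{d}{dt}R = Q(R)$ if every solution $R(t)$, $t \in [0,T)$, with $R(0) \in F$ satisfies $R(t) \in F$ for all $t \in [0,T)$. Let $E$ be the set of all $R \in S_B^2(\mathfrak{so}(n))$ such that the curvature operator $S$ on $\mathbb{R}^n \times \mathbb{R}^2$ defined by \[S(\hat v_1,\hat v_2,\hat v_3,\hat v_4) = R(v_1,v_2,v_3,v_4) + \langle x_1,x_3\rangle \langle x_2,x_4\rangle - \langle x_1,x_4\rangle\langle x_2,x_3\rangle, \qquad \hat v_j = (v_j,x_j),\] has nonnegative isotropic curvature, i.e. \[S(e_1,e_3,e_1,e_3)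 + S(e_1,e_4,e_1,e_4) + S(e_2,e_3,e_2,e_3) + S(e_2,e_4,e_2,e_4) - 2\,S(e_1,e_2,e_3,e_4) \geq 0\] for all orthonormal four-frames $\{e_1,e_2,e_3,e_4\}$ in $\mathbb{R}^n \times \mathbb{R}^2$. For real numbers $a,b$ define the Böhm–Wilking transformation \[\ell_{a,b}(R) = R + b \, \mathrm{Ric}_0 \odot \mathrm{id} + \frac{a}{n}\, \mathrm{scal} \; \mathrm{id} \odot \mathrm{id},\] where $\odot$ is the Kulkarni–Nomizu product given below, $\mathrm{Ric}_{ik} = \sum_p R_{ipkp}$, $\mathrm{scal} = \sum_i \mathrm{Ric}_{ii}$, $\mathrm{Ric}_0 = \mathrm{Ric} - \frac{\mathrm{scal}}{n}\,\mathrm{id}$, and $(A \odot B)_{ijkl} = A_{ik}B_{jl} - A_{il}B_{jk} - A_{jk}B_{il} + A_{jl}B_{ik}$. If $b \in \Big(0, \frac{\sqrt{2n(n-2)+4}-2}{n(n-2)}\Big]$ and $2a = 2b + (n-2)b^2$, then the set $\ell_{a,b}(E)$ is invariant under the Hamilton ODE $\frac{d}{dt}R = Q(R)$. -/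

import Mathlib

open scoped BigOperators

noncomputable section

namespace HamiltonODE

/-- Real `n × n` arrays of components `T i j k l` of a 4-tensor on `ℝⁿ` (in the standard basis). -/
abbrev Tensor4 (n : ℕ) : Type := Fin n → Fin n → Fin n → Fin n → ℝ

/-- The space `S_B²(so(n))` of algebraic curvature operators on `ℝⁿ`: the 4-tensors that are
antisymmetric in the first pair of indices, symmetric under exchange of the two pairs (hence also
antisymmetric in the second pair), and satisfy the first Bianchi identity. -/
def CurvOp (n : ℕ) : Submodule ℝ (Tensor4 n) where
  carrier := {R | (∀ i j k l, R j i k l = -R i j k l) ∧ (∀ i j k l, R k l i j = R i j k l) ∧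
    (∀ i j k l, R i j k l + R i k l j + R i l j k = 0)}
  add_mem' := by
    rintro R S ⟨h1, h2, h3⟩ ⟨g1, g2, g3⟩
    refine ⟨fun i j k l => ?_, fun i j k l => ?_, fun i j k l => ?_⟩
    · simp only [Pi.add_apply, h1 i j, g1 i j]; ring
    · simp only [Pi.add_apply, h2 i j, g2 i j]
    · have := h3 i j k l
      have := g3 i j k l
      simp only [Pi.add_apply]; linarith
  zero_mem' := by simp
  smul_mem' := by
    rintro c R ⟨h1, h2, h3⟩
    refine ⟨fun i j k l => ?_, fun i j k l => ?_, fun i j k l => ?_⟩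
    · simp only [Pi.smul_apply, smul_eq_mul, h1 i j]; ring
    · simp only [Pi.smul_apply, smul_eq_mul, h2 i j]
    · simp only [Pi.smul_apply, smul_eq_mul, ← mul_add, h3, mul_zero]

/-- The components
`Q(R)ᵢⱼₖₗ = Rᵢⱼₚq Rₖₗₚq + 2 Rᵢₚₖq Rⱼₚₗq - 2 Rᵢₚₗq Rⱼₚₖq` (summed over `p, q`). -/
def QTensor {n : ℕ} (R : Tensor4 n) : Tensor4 n := fun i j k l =>
  ∑ p, ∑ q, (R i j p q * R k l p q + 2 * R i p k q * R j p l q - 2 * R i p l q * R j p k q)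

theorem QTensor_mem {n : ℕ} {R : Tensor4 n} (hR : R ∈ CurvOp n) : QTensor R ∈ CurvOp n := by
  obtain ⟨h1, h2, h3⟩ := hR
  let A : Fin n → Fin n → Fin n → Fin n → ℝ :=
    fun i j k l => ∑ p, ∑ q, R i p j q * R k p l q
  have hA : ∀ i j k l, QTensor R i j k l =
      2 * (A i j k l - A i j l k + A i k j l - A i l j k) := by
    intro i j k l
    have e : ∀ i j p q, R i j p q = R i p j q - R i q j p := by
      intro i j p q
      have := h3 i j p q
      have a1 := h2 p i j q
      have a2 := h1 p i j q
      have a3 := h2 i q j p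
      have a4 := h1 j p i q
      have a5 := h2 i p q j
      have a6 := h1 j q i p
      have a7 := h2 i p j q
      linarith
    have s1 : ∑ p, ∑ q, R i q j p * R k q l p = A i j k l := Finset.sum_comm
    have s2 : ∑ p, ∑ q, R i p j q * R k q l p = A i j l k := by
      refine Finset.sum_congr rfl fun p _ => Finset.sum_congr rfl fun q _ => ?_
      rw [h2 l p k q]
    have s3 : ∑ p, ∑ q, R i q j p * R k p l q = A i j l k := by
      rw [Finset.sum_comm]
      exact s2
    have : QTensor R i j k l = (∑ p, ∑ q, R i p j q * R k p l q)
        - (∑ p, ∑ q, R i p j q * R k q l p) - (∑ p, ∑ q, R i q j p * R k p l q)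
        + (∑ p, ∑ q, R i q j p * R k q l p)
        + 2 * (∑ p, ∑ q, R i p k q * R j p l q) - 2 * (∑ p, ∑ q, R i p l q * R j p k q) := by
      simp only [QTensor, Finset.mul_sum, ← Finset.sum_add_distrib, ← Finset.sum_sub_distrib]
      refine Finset.sum_congr rfl fun p _ => Finset.sum_congr rfl fun q _ => ?_
      rw [e i j p q, e k l p q]
      ring
    rw [this, s1, s2, s3]
    simp only [A]
    ring
  have hs : ∀ i j k l, A k l i j = A i j k l := by
    intro i j k l
    refine Finset.sum_congr rfl fun p _ => Finset.sum_congr rfl fun q _ => ?_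
    ring
  have ht : ∀ i j k l, A j i l k = A i j k l := by
    intro i j k l
    simp only [A]
    rw [Finset.sum_comm]
    refine Finset.sum_congr rfl fun p _ => Finset.sum_congr rfl fun q _ => ?_
    rw [h2 i p j q, h2 k p l q]
  refine ⟨fun i j k l => ?_, fun i j k l => ?_, fun i j k l => ?_⟩
  · rw [hA, hA, ht i j l k, ht i j k l, hs i l j k, hs i k j l]; ring
  · rw [hA, hA, hs i j k l, hs j i k l, ht i j l k, ht i k j l, ht j k i l, hs i l j k]
  · rw [hA, hA, hA]; ring

/-- The quadratic vector field `R ↦ Q(R)` on the space of algebraic curvature operators. -/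
def Q {n : ℕ} (R : CurvOp n) : CurvOp n := ⟨QTensor R.1, QTensor_mem R.2⟩

/-- The value `R(v₁,v₂,v₃,v₄)` of an algebraic curvature operator on vectors of `ℝⁿ`. -/
def evalVec {n : ℕ} (R : CurvOp n) (v₁ v₂ v₃ v₄ : EuclideanSpace ℝ (Fin n)) : ℝ :=
  ∑ i, ∑ j, ∑ k, ∑ l, R.1 i j k l * v₁ i * v₂ j * v₃ k * v₄ l

/-- A 4-tensor `T` on a real inner product space (regarded as a curvature tensor) has nonnegative
isotropic curvature. -/
def NonnegIsotropic {V : Type*} [NormedAddCommGroup V] [InnerProductSpace ℝ V]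
    (T : V → V → V → V → ℝ) : Prop :=
  ∀ e₁ e₂ e₃ e₄ : V, Orthonormal ℝ ![e₁, e₂, e₃, e₄] →
    0 ≤ T e₁ e₃ e₁ e₃ + T e₁ e₄ e₁ e₄ + T e₂ e₃ e₂ e₃ + T e₂ e₄ e₂ e₄ - 2 * T e₁ e₂ e₃ e₄

/-- The Euclidean space `ℝⁿ × ℝ²` (with the product inner product). -/
abbrev ProdPlane (n : ℕ) : Type :=
  WithLp 2 (EuclideanSpace ℝ (Fin n) × EuclideanSpace ℝ (Fin 2))

/-- The curvature tensor `S` induced by `R` on `ℝⁿ × ℝ²`, the curvature of the product with the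
unit 2-sphere. -/
def inducedS {n : ℕ} (R : CurvOp n) (w₁ w₂ w₃ w₄ : ProdPlane n) : ℝ :=
  evalVec R w₁.fst w₂.fst w₃.fst w₄.fst
    + inner ℝ w₁.snd w₃.snd * inner ℝ w₂.snd w₄.snd
    - inner ℝ w₁.snd w₄.snd * inner ℝ w₂.snd w₃.snd

/-- The set `E` of all algebraic curvature operators `R` on `ℝⁿ` such that the induced curvature
tensor `S` on `ℝⁿ × ℝ²` has nonnegative isotropic curvature. -/
def E (n : ℕ) : Set (CurvOp n) := {R | NonnegIsotropic (inducedS R)}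

/-- The Ricci tensor `Ricᵢₖ = ∑ₚ Rᵢₚₖₚ`. -/
def ric {n : ℕ} (R : Tensor4 n) : Matrix (Fin n) (Fin n) ℝ :=
  Matrix.of fun i k => ∑ p, R i p k p

/-- The scalar curvature. -/
def scal {n : ℕ} (R : Tensor4 n) : ℝ := (ric R).trace

/-- The trace-free Ricci tensor. -/
def ric₀ {n : ℕ} (R : Tensor4 n) : Matrix (Fin n) (Fin n) ℝ :=
  ric R - (scal R / n) • (1 : Matrix (Fin n) (Fin n) ℝ)

/-- The Kulkarni–Nomizu product. -/
def kn {n : ℕ} (A B : Matrix (Fin n) (Fin n) ℝ) : Tensor4 n := fun i j k l =>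
  A i k * B j l - A i l * B j k - A j k * B i l + A j l * B i k

theorem kn_mem {n : ℕ} {A B : Matrix (Fin n) (Fin n) ℝ} (hA : A.IsSymm) (hB : B.IsSymm) :
    kn A B ∈ CurvOp n := by
  refine ⟨fun i j k l => ?_, fun i j k l => ?_, fun i j k l => ?_⟩
  · simp only [kn]; ring
  · simp only [kn, hA.apply i k, hA.apply j l, hA.apply i l, hA.apply j k,
      hB.apply i k, hB.apply j l, hB.apply i l, hB.apply j k]
    ring
  · simp only [kn, hA.apply j k, hA.apply j l, hA.apply k l,
      hB.apply j k, hB.apply j l, hB.apply k l]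
    ring

theorem ric_isSymm {n : ℕ} {R : Tensor4 n} (hR : R ∈ CurvOp n) : (ric R).IsSymm := by
  refine Matrix.IsSymm.ext fun i k => ?_
  simp only [ric, Matrix.of_apply]
  exact Finset.sum_congr rfl fun p _ => hR.2.1 i p k p

theorem ric₀_isSymm {n : ℕ} {R : Tensor4 n} (hR : R ∈ CurvOp n) : (ric₀ R).IsSymm :=
  (ric_isSymm hR).sub (Matrix.isSymm_one.smul _)

/-- The components of `R + b Ric₀ ⊙ id + (a/n) scal id ⊙ id`, with `⊙` the Kulkarni–Nomizu
product. -/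
def ellTensor {n : ℕ} (a b : ℝ) (R : Tensor4 n) : Tensor4 n :=
  R + b • kn (ric₀ R) 1 + (a / n * scal R) • kn 1 1

theorem ellTensor_mem {n : ℕ} (a b : ℝ) {R : Tensor4 n} (hR : R ∈ CurvOp n) :
    ellTensor a b R ∈ CurvOp n :=
  (CurvOp n).add_mem
    ((CurvOp n).add_mem hR ((CurvOp n).smul_mem _ (kn_mem (ric₀_isSymm hR) Matrix.isSymm_one)))
    ((CurvOp n).smul_mem _ (kn_mem Matrix.isSymm_one Matrix.isSymm_one))

/-- The transformation `ℓ_{a,b}` of the space of algebraic curvature operators. -/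
def ell {n : ℕ} (a b : ℝ) (R : CurvOp n) : CurvOp n := ⟨ellTensor a b R.1, ellTensor_mem a b R.2⟩

/-- The set `F` is invariant under the ODE `d/dt R = X(R)`: every solution on an interval `[0,T)`
that starts in `F` stays in `F`. (At `t = 0` the derivative is one-sided.) -/
def InvariantUnderODE {V : Type*} [NormedAddCommGroup V] [NormedSpace ℝ V]
    (X : V → V) (F : Set V) : Prop :=
  ∀ (T : ℝ) (R : ℝ → V),
    (∀ t ∈ Set.Ico 0 T, HasDerivWithinAt R (X (R t)) (Set.Ico 0 T) t) →
    R 0 ∈ F → ∀ t ∈ Set.Ico 0 T, R t ∈ F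

end HamiltonODE

end

/-! Write R(M, M̄) for `herm R M M`. The set `E` consists of the R with R(M, M̄) + 2|tr(M Mᵀ)| ≥ 0
for every decomposable complex bivector M = ζ ∧ η (`mem_E_iff`). Orthonormal four-frames of ℝⁿ × ℝ²
are unitary bases, up to scale, of isotropic complex planes. Any ζ, η extend to an isotropic pair
because ℂ² realises every symmetric 2 × 2 Gram matrix. The sphere then contributes the modulus of a
Gram determinant, which isotropy expresses through ζ and η alone.

Since ℓ_{a,b} is invertible, it suffices to show that `E` is invariant under the pulled-back
equation. By `QTensor_ellTensor` this equation is R' = Q(R) + D(R), with D = `reaction`: a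
combination of Ric ⊙ Ric, Ric₀² ⊙ id and |Ric₀|² id ⊙ id. The relation between a and b produces this
form, and the range of b makes all coefficients nonnegative. On `E` the Ricci tensor is nonnegative
(`ric_posSemidef`; here n ≥ 3 enters), so D(R)(M, M̄) ≥ 0.

For Q, let the defining expression vanish at M. Moving M by complex orthogonal transformations keeps
it decomposable and fixes tr(M Mᵀ). The second variation in the directions x and ix gives R([x, M],
conj [x, M]) ≥ 0 (`herm_commutator_nonneg`). A trace argument (`sharp_nonneg`) turns this into
Q(R)(M, M̄) ≥ 0.

A maximum principle (`isoForm_nonneg_invariant`) concludes: compactness of the unit decomposable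
bivectors yields a first time at which a barrier in the direction id ⊙ id is touched. -/

/-! ### A trace inequality for Hermitian matrices. -/

open Matrix in
-- In an eigenbasis of B the trace is ∑ l_α ⟨v_α, A v_α⟩. Terms with l_α = 0 drop out, and for l_α >
-- 0 the vector v_α lies in the range of B, the only place where positivity of A is needed.
theorem Matrix.IsHermitian.re_trace_mul_nonneg {ι : Type*} [Fintype ι] [DecidableEq ι]
    {B : Matrix ι ι ℂ} (hB : B.IsHermitian) (A : Matrix ι ι ℂ)
    (hpos : ∀ x, 0 ≤ (star x ⬝ᵥ B *ᵥ x).re)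
    (hA : ∀ x, 0 ≤ (star (B *ᵥ x) ⬝ᵥ A *ᵥ (B *ᵥ x)).re) : 0 ≤ (trace (B * A)).re := by
  set U : Matrix ι ι ℂ := (hB.eigenvectorUnitary : Matrix ι ι ℂ) with hU
  let v : ι → ι → ℂ := fun α => ⇑(hB.eigenvectorBasis α)
  have hv : ∀ α, B *ᵥ v α = (hB.eigenvalues α : ℂ) • v α := fun α => by
    simpa using hB.mulVec_eigenvectorBasis α
  have hBU : B * U = U * diagonal (fun α => (hB.eigenvalues α : ℂ)) := by
    ext i α
    have := congrFun (hv α) i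
    simp only [mul_diagonal, hU, Matrix.IsHermitian.eigenvectorUnitary_apply]
    simp only [Pi.smul_apply, smul_eq_mul, v] at this
    rw [mul_comm _ (hB.eigenvalues α : ℂ), ← this]
    simp [mul_apply, mulVec, dotProduct, Matrix.IsHermitian.eigenvectorUnitary_apply]
  have hUU : U * star U = 1 := Unitary.coe_mul_star_self _
  have htr : trace (B * A) = ∑ α, (hB.eigenvalues α : ℂ) * (star (v α) ⬝ᵥ A *ᵥ v α) := by
    have h1 : trace (B * A) = trace (diagonal (fun α => (hB.eigenvalues α : ℂ)) *
        (star U * A * U)) := by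
      calc trace (B * A) = trace (B * (U * star U) * A) := by rw [hUU, mul_one]
        _ = trace (U * (diagonal (fun α => (hB.eigenvalues α : ℂ)) * (star U * A))) := by
            rw [← mul_assoc, hBU]; simp only [mul_assoc]
        _ = _ := by rw [trace_mul_comm]; simp only [mul_assoc]
    rw [h1]
    simp only [trace, diag_apply, diagonal_mul]
    refine Finset.sum_congr rfl fun α _ => ?_
    congr 1
    rw [mul_assoc]
    simp only [mul_apply, dotProduct, mulVec, star_apply, v, Pi.star_apply, hU,
      Matrix.IsHermitian.eigenvectorUnitary_apply]
  rw [htr, Complex.re_sum]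
  refine Finset.sum_nonneg fun α _ => ?_
  rw [Complex.re_ofReal_mul]
  set l := hB.eigenvalues α
  have h1 := hpos (v α)
  have h2 := hA (v α)
  rw [hv α] at h1 h2
  have e1 : (star (v α) ⬝ᵥ ((l : ℂ) • v α)).re = l * ∑ i, Complex.normSq (v α i) := by
    rw [dotProduct_smul, smul_eq_mul, Complex.re_ofReal_mul]
    simp [dotProduct, Complex.re_sum, Complex.normSq_apply]
  have e2 : (star ((l : ℂ) • v α) ⬝ᵥ A *ᵥ ((l : ℂ) • v α)).re =
      l * (l * (star (v α) ⬝ᵥ A *ᵥ v α).re) := by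
    rw [mulVec_smul, dotProduct_smul, star_smul, smul_dotProduct]
    simp
  rw [e1] at h1
  rw [e2] at h2
  -- A negative eigenvalue contradicts positivity of B; here this appears as `v α = 0`, so that no
  -- normalisation of the eigenvectors is needed.
  rcases lt_trichotomy l 0 with hl | hl | hl
  · have hs : 0 ≤ ∑ i, Complex.normSq (v α i) :=
      Finset.sum_nonneg fun i _ => Complex.normSq_nonneg _
    have hs0 : ∑ i, Complex.normSq (v α i) = 0 := by nlinarith
    have hz : v α = 0 := by
      funext i
      have := (Finset.sum_eq_zero_iff_of_nonneg
        (fun i _ => Complex.normSq_nonneg (v α i))).1 hs0 i (Finset.mem_univ i)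
      simpa using this
    simp [hz]
  · simp [hl]
  · exact nonneg_of_mul_nonneg_right h2 hl

namespace HamiltonODE

open Matrix

variable {n : ℕ}

/-! ### The sesquilinear form of a curvature tensor. -/

theorem star_ofReal (x : ℝ) : star (x : ℂ) = x := Complex.conj_ofReal x

/-- The sesquilinear extension `∑ Rᵢⱼₖₗ Xᵢⱼ conj(Yₖₗ)` of a 4-tensor to complex matrices. -/
noncomputable def herm (R : Tensor4 n) (X Y : Matrix (Fin n) (Fin n) ℂ) : ℂ :=
  ∑ i, ∑ j, ∑ k, ∑ l, (R i j k l : ℂ) * X i j * star (Y k l)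

theorem herm_add_left (R : Tensor4 n) (X X' Y : Matrix (Fin n) (Fin n) ℂ) :
    herm R (X + X') Y = herm R X Y + herm R X' Y := by
  simp only [herm, Matrix.add_apply, mul_add, add_mul, Finset.sum_add_distrib]

theorem herm_add_right (R : Tensor4 n) (X Y Y' : Matrix (Fin n) (Fin n) ℂ) :
    herm R X (Y + Y') = herm R X Y + herm R X Y' := by
  simp only [herm, Matrix.add_apply, mul_add, star_add, Finset.sum_add_distrib]

theorem herm_smul_left (R : Tensor4 n) (c : ℂ) (X Y : Matrix (Fin n) (Fin n) ℂ) :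
    herm R (c • X) Y = c * herm R X Y := by
  simp only [herm, Matrix.smul_apply, smul_eq_mul, Finset.mul_sum]
  refine Finset.sum_congr rfl fun i _ => Finset.sum_congr rfl fun j _ =>
    Finset.sum_congr rfl fun k _ => Finset.sum_congr rfl fun l _ => ?_
  ring

theorem herm_smul_right (R : Tensor4 n) (c : ℂ) (X Y : Matrix (Fin n) (Fin n) ℂ) :
    herm R X (c • Y) = star c * herm R X Y := by
  simp only [herm, Matrix.smul_apply, smul_eq_mul, star_mul', Finset.mul_sum]
  refine Finset.sum_congr rfl fun i _ => Finset.sum_congr rfl fun j _ =>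
    Finset.sum_congr rfl fun k _ => Finset.sum_congr rfl fun l _ => ?_
  ring

theorem herm_neg_left (R : Tensor4 n) (X Y : Matrix (Fin n) (Fin n) ℂ) :
    herm R (-X) Y = -herm R X Y := by
  simpa using herm_smul_left R (-1) X Y

theorem herm_neg_right (R : Tensor4 n) (X Y : Matrix (Fin n) (Fin n) ℂ) :
    herm R X (-Y) = -herm R X Y := by
  simpa using herm_smul_right R (-1) X Y

theorem herm_sub_left (R : Tensor4 n) (X X' Y : Matrix (Fin n) (Fin n) ℂ) :
    herm R (X - X') Y = herm R X Y - herm R X' Y := by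
  rw [sub_eq_add_neg, herm_add_left, herm_neg_left, sub_eq_add_neg]

theorem herm_sub_right (R : Tensor4 n) (X Y Y' : Matrix (Fin n) (Fin n) ℂ) :
    herm R X (Y - Y') = herm R X Y - herm R X Y' := by
  rw [sub_eq_add_neg, herm_add_right, herm_neg_right, sub_eq_add_neg]

theorem herm_add_tensor (R S : Tensor4 n) (X Y : Matrix (Fin n) (Fin n) ℂ) :
    herm (R + S) X Y = herm R X Y + herm S X Y := by
  simp only [herm, Pi.add_apply, Complex.ofReal_add, add_mul, Finset.sum_add_distrib]

theorem herm_smul_tensor (c : ℝ) (R : Tensor4 n) (X Y : Matrix (Fin n) (Fin n) ℂ) :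
    herm (c • R) X Y = c * herm R X Y := by
  simp only [herm, Pi.smul_apply, smul_eq_mul, Finset.mul_sum, Complex.ofReal_mul, mul_assoc]

theorem antisymm_right {R : Tensor4 n} (hR : R ∈ CurvOp n) (i j k l : Fin n) :
    R i j l k = -R i j k l := by
  rw [← hR.2.1 i j l k, hR.1, hR.2.1]

theorem swap_both {R : Tensor4 n} (hR : R ∈ CurvOp n) (i j k l : Fin n) :
    R j i l k = R i j k l := by
  rw [hR.1, antisymm_right hR, neg_neg]

theorem herm_transpose_left {R : Tensor4 n} (hR : R ∈ CurvOp n)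
    (X Y : Matrix (Fin n) (Fin n) ℂ) : herm R Xᵀ Y = -herm R X Y := by
  simp only [herm]
  rw [Finset.sum_comm]
  simp only [← Finset.sum_neg_distrib]
  refine Finset.sum_congr rfl fun i _ => Finset.sum_congr rfl fun j _ =>
    Finset.sum_congr rfl fun k _ => Finset.sum_congr rfl fun l _ => ?_
  rw [hR.1 i j]; simp

theorem star_herm {R : Tensor4 n} (hR : R ∈ CurvOp n) (X Y : Matrix (Fin n) (Fin n) ℂ) :
    star (herm R X Y) = herm R Y X := by
  have e : ∀ f : Fin n → Fin n → Fin n → Fin n → ℂ, ∑ i, ∑ j, ∑ k, ∑ l, f i j k l =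
      ∑ k, ∑ l, ∑ i, ∑ j, f i j k l := fun f => by
    simp only [← Fintype.sum_prod_type' (fun i j => ∑ k, ∑ l, f i j k l)]
    rw [Finset.sum_comm]
    refine Finset.sum_congr rfl fun k _ => ?_
    rw [Finset.sum_comm]
    refine Finset.sum_congr rfl fun l _ => ?_
    rw [Fintype.sum_prod_type]
  rw [herm, e]
  simp only [star_sum, herm]
  refine Finset.sum_congr rfl fun i _ => Finset.sum_congr rfl fun j _ =>
    Finset.sum_congr rfl fun k _ => Finset.sum_congr rfl fun l _ => ?_
  rw [hR.2.1 i j k l]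
  simp only [star_mul', star_star, star_ofReal]
  ring

theorem herm_transpose_right {R : Tensor4 n} (hR : R ∈ CurvOp n)
    (X Y : Matrix (Fin n) (Fin n) ℂ) : herm R X Yᵀ = -herm R X Y := by
  rw [← star_herm hR, herm_transpose_left hR, star_neg, star_herm hR]

/-- For antisymmetric w and M, M w is the transpose of w M, and each transposition costs a sign. So
the four terms of the expansion agree. -/
theorem herm_commutator {R : Tensor4 n} (hR : R ∈ CurvOp n) {w M : Matrix (Fin n) (Fin n) ℂ}
    (hw : wᵀ = -w) (hM : Mᵀ = -M) :
    herm R (w * M - M * w) (w * M - M * w) = 4 * herm R (w * M) (w * M) := by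
  have h : M * w = (w * M)ᵀ := by rw [transpose_mul, hw, hM, neg_mul_neg]
  rw [h, herm_sub_left, herm_sub_right, herm_sub_right, herm_transpose_left hR,
    herm_transpose_right hR, herm_transpose_left hR, herm_transpose_right hR]
  ring

/-! ### The sharp term of Q. -/

theorem sum5_reorder (f : Fin n → Fin n → Fin n → Fin n → Fin n → ℂ) :
    ∑ m, ∑ k, ∑ r, ∑ j, ∑ l, f m k r j l = ∑ j, ∑ k, ∑ l, ∑ m, ∑ r, f m k r j l := by
  let e : (Fin n × Fin n × Fin n × Fin n × Fin n) ≃ (Fin n × Fin n × Fin n × Fin n × Fin n) :=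
    ⟨fun x => (x.2.2.2.1, x.2.1, x.2.2.2.2, x.1, x.2.2.1),
      fun x => (x.2.2.2.1, x.2.1, x.2.2.2.2, x.1, x.2.2.1), fun _ => rfl, fun _ => rfl⟩
  have := Equiv.sum_comp e (fun x => f x.2.2.2.1 x.2.1 x.2.2.2.2 x.1 x.2.2.1)
  simp only [Fintype.sum_prod_type] at this
  exact this

theorem sum6_reorder (f : Fin n → Fin n → Fin n → Fin n → Fin n → Fin n → ℂ) :
    ∑ i, ∑ m, ∑ k, ∑ r, ∑ j, ∑ l, f i m k r j l =
      ∑ m, ∑ j, ∑ r, ∑ l, ∑ i, ∑ k, f i m k r j l := by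
  let e : (Fin n × Fin n × Fin n × Fin n × Fin n × Fin n) ≃
      (Fin n × Fin n × Fin n × Fin n × Fin n × Fin n) :=
    ⟨fun x => (x.2.1, x.2.2.2.2.1, x.2.2.2.1, x.2.2.2.2.2, x.1, x.2.2.1),
      fun x => (x.2.2.2.2.1, x.1, x.2.2.2.2.2, x.2.2.1, x.2.1, x.2.2.2.1),
      fun _ => rfl, fun _ => rfl⟩
  have := Equiv.sum_comp e (fun x => f x.2.2.2.2.1 x.1 x.2.2.2.2.2 x.2.2.1 x.2.1 x.2.2.2.1)
  simp only [Fintype.sum_prod_type] at this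
  exact this

theorem sum6_reorder' (f : Fin n → Fin n → Fin n → Fin n → Fin n → Fin n → ℂ) :
    ∑ i, ∑ j, ∑ k, ∑ l, ∑ p, ∑ q, f i j k l p q =
      ∑ p, ∑ q, ∑ i, ∑ j, ∑ k, ∑ l, f i j k l p q := by
  let e : (Fin n × Fin n × Fin n × Fin n × Fin n × Fin n) ≃
      (Fin n × Fin n × Fin n × Fin n × Fin n × Fin n) :=
    ⟨fun x => (x.2.2.2.2.1, x.2.2.2.2.2, x.1, x.2.1, x.2.2.1, x.2.2.2.1),
      fun x => (x.2.2.1, x.2.2.2.1, x.2.2.2.2.1, x.2.2.2.2.2, x.1, x.2.1),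
      fun _ => rfl, fun _ => rfl⟩
  have := Equiv.sum_comp e
    (fun x => f x.2.2.1 x.2.2.2.1 x.2.2.2.2.1 x.2.2.2.2.2 x.1 x.2.1)
  simp only [Fintype.sum_prod_type] at this
  exact this

/-- If `R` is nonnegative on all `[Z, M]`, then the quadratic expression
`∑ Rᵢₚₖq Rⱼₚₗq Mᵢⱼ conj(Mₖₗ)` is nonnegative. -/
theorem sharp_nonneg {R : Tensor4 n} (hR : R ∈ CurvOp n) {M : Matrix (Fin n) (Fin n) ℂ}
    (hM : Mᵀ = -M)
    (hpos : ∀ Z : Matrix (Fin n) (Fin n) ℂ, Zᵀ = -Z →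
      0 ≤ (herm R (Z * M - M * Z) (Z * M - M * Z)).re) :
    0 ≤ (∑ i, ∑ j, ∑ k, ∑ l, ∑ p, ∑ q,
      (R i p k q : ℂ) * R j p l q * M i j * star (M k l)).re := by
  -- `b` contracts two slots of R with M and its conjugate, so the desired sum pairs `b` with R. `B`
  -- antisymmetrises `b` in both index pairs, and `A` is R acting on bivectors; the sum becomes a
  -- quarter of tr(BA).
  let b : Fin n → Fin n → Fin n → Fin n → ℂ := fun i m k r =>
    ∑ j, ∑ l, (R i j k l : ℂ) * M m j * star (M r l)
  let B : Matrix (Fin n × Fin n) (Fin n × Fin n) ℂ := fun p q =>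
    b p.1 p.2 q.1 q.2 - b p.2 p.1 q.1 q.2 - b p.1 p.2 q.2 q.1 + b p.2 p.1 q.2 q.1
  let A : Matrix (Fin n × Fin n) (Fin n × Fin n) ℂ := of fun p q => (R q.1 q.2 p.1 p.2 : ℂ)
  have hb : ∀ i m k r, star (b i m k r) = b k r i m := fun i m k r => by
    simp only [b, star_sum]
    rw [Finset.sum_comm]
    refine Finset.sum_congr rfl fun j _ => Finset.sum_congr rfl fun l _ => ?_
    rw [hR.2.1 i l k j]
    simp only [star_mul', star_star, star_ofReal]
    ring
  have hB : B.IsHermitian := by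
    refine Matrix.IsHermitian.ext fun p q => ?_
    simp only [B, star_add, star_sub, hb]
    ring
  have s12 : ∀ f : Fin n → Fin n → Fin n → Fin n → ℂ, ∑ i, ∑ j, ∑ k, ∑ l, f i j k l =
      ∑ i, ∑ j, ∑ k, ∑ l, f j i k l := fun f => Finset.sum_comm
  have s34 : ∀ f : Fin n → Fin n → Fin n → Fin n → ℂ, ∑ i, ∑ j, ∑ k, ∑ l, f i j k l =
      ∑ i, ∑ j, ∑ k, ∑ l, f i j l k := fun f =>
    Finset.sum_congr rfl fun i _ => Finset.sum_congr rfl fun j _ => Finset.sum_comm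
  have hBsum : ∀ c : Fin n → Fin n → Fin n → Fin n → ℂ,
      ∑ i, ∑ m, ∑ k, ∑ r, B (i, m) (k, r) * c i m k r =
      ∑ i, ∑ m, ∑ k, ∑ r, b i m k r * (c i m k r - c m i k r - c i m r k + c m i r k) := by
    intro c
    simp only [B, mul_add, mul_sub, add_mul, sub_mul, Finset.sum_add_distrib,
      Finset.sum_sub_distrib]
    rw [s12 (fun i m k r => b m i k r * c i m k r), s34 (fun i m k r => b i m r k * c i m k r),
      s12 (fun i m k r => b m i r k * c i m k r), s34 (fun i m k r => b i m r k * c m i k r)]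
  have key : ∀ w v : Matrix (Fin n) (Fin n) ℂ,
      ∑ i, ∑ m, ∑ k, ∑ r, b i m k r * (w i m * star (v k r)) = herm R (w * M) (v * M) := by
    intro w v
    simp only [b, herm, mul_apply, Finset.sum_mul, Finset.mul_sum, star_sum]
    refine Finset.sum_congr rfl fun i _ => ?_
    rw [sum5_reorder (fun m k r j l =>
      (R i j k l : ℂ) * M m j * star (M r l) * (w i m * star (v k r)))]
    refine Finset.sum_congr rfl fun j _ => Finset.sum_congr rfl fun k _ =>
      Finset.sum_congr rfl fun l _ => ?_
    rw [Finset.sum_comm]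
    refine Finset.sum_congr rfl fun r _ => Finset.sum_congr rfl fun m _ => ?_
    rw [star_mul']
    ring
  have hBpos : ∀ x, 0 ≤ (star x ⬝ᵥ B *ᵥ x).re := by
    intro x
    let w : Matrix (Fin n) (Fin n) ℂ := of fun i m => star (x (i, m)) - star (x (m, i))
    have hw : wᵀ = -w := by ext i m; simp [w]
    have h1 : star x ⬝ᵥ B *ᵥ x = herm R (w * M) (w * M) := by
      rw [← key]
      have h2 : star x ⬝ᵥ B *ᵥ x =
          ∑ i, ∑ m, ∑ k, ∑ r, B (i, m) (k, r) * (star (x (i, m)) * x (k, r)) := by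
        simp only [dotProduct, mulVec, Finset.mul_sum, Fintype.sum_prod_type, Pi.star_apply]
        refine Finset.sum_congr rfl fun i _ => Finset.sum_congr rfl fun j _ =>
          Finset.sum_congr rfl fun k _ => Finset.sum_congr rfl fun l _ => ?_
        ring
      rw [h2, hBsum]
      refine Finset.sum_congr rfl fun i _ => Finset.sum_congr rfl fun j _ =>
        Finset.sum_congr rfl fun k _ => Finset.sum_congr rfl fun l _ => ?_
      simp only [w, of_apply, star_sub, star_star]
      ring
    rw [h1]
    have h3 := hpos w hw
    rw [herm_commutator hR hw hM] at h3
    have h4 : ((4 : ℂ) * herm R (w * M) (w * M)).re = 4 * (herm R (w * M) (w * M)).re := by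
      simp
    rw [h4] at h3
    linarith
  -- The range of `B` consists of commutators with M. Thus `hpos` makes `A` nonnegative there,
  -- though not on all bivectors.
  have hBim : ∀ x, ∃ Z : Matrix (Fin n) (Fin n) ℂ, Zᵀ = -Z ∧
      ∀ i m, (B *ᵥ x) (i, m) = (M * Z - Z * M) i m := by
    intro x
    let y : Fin n → Fin n → ℂ := fun k r => x (k, r) - x (r, k)
    let Z : Matrix (Fin n) (Fin n) ℂ := fun i j =>
      ∑ k, ∑ r, ∑ l, (R i j k l : ℂ) * star (M r l) * y k r
    have hZ : ∀ i j, Z j i = -Z i j := fun i j => by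
      simp only [Z, hR.1 i j, ← Finset.sum_neg_distrib]
      simp
    have hc : ∀ i m, ∑ k, ∑ r, b i m k r * y k r = ∑ j, M m j * Z i j := by
      intro i m
      simp only [b, Z, Finset.sum_mul, Finset.mul_sum]
      rw [Finset.sum_congr rfl fun k _ => Finset.sum_comm, Finset.sum_comm]
      refine Finset.sum_congr rfl fun j _ => Finset.sum_congr rfl fun k _ =>
        Finset.sum_congr rfl fun r _ => Finset.sum_congr rfl fun l _ => ?_
      ring
    refine ⟨Z, by ext i j; simp [hZ i j], fun i m => ?_⟩
    have h1 : (B *ᵥ x) (i, m) = ∑ k, ∑ r, b i m k r * y k r - ∑ k, ∑ r, b m i k r * y k r := by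
      have s2 : ∀ f : Fin n → Fin n → ℂ, ∑ k, ∑ r, f r k * x (k, r) =
        ∑ k, ∑ r, f k r * x (r, k) := fun f => Finset.sum_comm
      simp only [mulVec, dotProduct, Fintype.sum_prod_type, B, y, add_mul, sub_mul, mul_sub,
        Finset.sum_add_distrib, Finset.sum_sub_distrib]
      rw [s2 (b i m), s2 (b m i)]
      ring
    have hM' : ∀ i j, M j i = -M i j := fun i j => congrFun (congrFun hM i) j
    rw [h1, hc, hc, Matrix.sub_apply, mul_apply, mul_apply, ← Finset.sum_sub_distrib,
      ← Finset.sum_sub_distrib]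
    refine Finset.sum_congr rfl fun j _ => ?_
    rw [hZ m j, hM' j m]
    ring
  have hA : ∀ x, 0 ≤ (star (B *ᵥ x) ⬝ᵥ A *ᵥ (B *ᵥ x)).re := by
    intro x
    obtain ⟨Z, hZ, hu⟩ := hBim x
    generalize B *ᵥ x = u at hu ⊢
    have h1 : star u ⬝ᵥ A *ᵥ u = star (herm R (M * Z - Z * M) (M * Z - Z * M)) := by
      simp only [dotProduct, mulVec, Finset.mul_sum, Fintype.sum_prod_type, Pi.star_apply, A, herm,
        of_apply, star_sum, hu]
      refine Finset.sum_congr rfl fun i _ => Finset.sum_congr rfl fun j _ =>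
        Finset.sum_congr rfl fun k _ => Finset.sum_congr rfl fun l _ => ?_
      rw [hR.2.1 i j k l]
      simp only [star_mul', star_star, star_ofReal]
      ring
    have h2 : M * Z - Z * M = -(Z * M - M * Z) := by abel
    rw [h1, star_herm hR, h2, herm_neg_left, herm_neg_right, neg_neg]
    exact hpos Z hZ
  have htr := hB.re_trace_mul_nonneg A hBpos hA
  have h1 : trace (B * A) = ∑ i, ∑ m, ∑ k, ∑ r, B (i, m) (k, r) * (R i m k r : ℂ) := by
    simp only [trace, diag_apply, mul_apply, Fintype.sum_prod_type, A, of_apply]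
  have h2 : trace (B * A) = 4 * ∑ i, ∑ m, ∑ k, ∑ r, b i m k r * (R i m k r : ℂ) := by
    rw [h1, hBsum]
    simp only [Finset.mul_sum]
    refine Finset.sum_congr rfl fun i _ => Finset.sum_congr rfl fun m _ =>
      Finset.sum_congr rfl fun k _ => Finset.sum_congr rfl fun r _ => ?_
    rw [swap_both hR i m k r, hR.1 i m k r, antisymm_right hR i m k r]
    push_cast
    ring
  have h3 : ∑ i, ∑ m, ∑ k, ∑ r, b i m k r * (R i m k r : ℂ) = ∑ i, ∑ j, ∑ k, ∑ l, ∑ p, ∑ q,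
      (R i p k q : ℂ) * R j p l q * M i j * star (M k l) := by
    simp only [b, Finset.sum_mul]
    rw [sum6_reorder]
    refine Finset.sum_congr rfl fun m _ => Finset.sum_congr rfl fun j _ =>
      Finset.sum_congr rfl fun r _ => Finset.sum_congr rfl fun l _ =>
      Finset.sum_congr rfl fun i _ => Finset.sum_congr rfl fun k _ => ?_
    rw [swap_both hR i m k r, swap_both hR i j k l]
    ring
  rw [h2, h3] at htr
  have h4 : ∀ z : ℂ, (4 * z).re = 4 * z.re := fun z => by simp
  rw [h4] at htr
  linarith

/-! ### Decomposable bivectors. -/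

/-- The quantity `R(M, conj M) + 2 |∑ Mᵢⱼ²|`. -/
noncomputable def isoForm (R : Tensor4 n) (M : Matrix (Fin n) (Fin n) ℂ) : ℝ :=
  (herm R M M).re + 2 * ‖trace (M * Mᵀ)‖

/-- The antisymmetric matrices that satisfy the Plücker relations, i.e. the decomposable
bivectors. -/
def IsDecomposable (M : Matrix (Fin n) (Fin n) ℂ) : Prop :=
  Mᵀ = -M ∧ ∀ i j k l, M i j * M k l - M i k * M j l + M i l * M j k = 0

/-- The bivector `ζ ∧ η`. -/
def wedge (ζ η : Fin n → ℂ) : Matrix (Fin n) (Fin n) ℂ :=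
  of fun i j => ζ i * η j - ζ j * η i

theorem wedge_eq (ζ η : Fin n → ℂ) :
    wedge ζ η = vecMulVec ζ η - vecMulVec η ζ := by
  ext i j
  simp [wedge, vecMulVec_apply, mul_comm]

theorem isDecomposable_wedge (ζ η : Fin n → ℂ) : IsDecomposable (wedge ζ η) := by
  refine ⟨?_, fun i j k l => ?_⟩
  · ext i j; simp [wedge]
  · simp only [wedge, of_apply]; ring

/-- If M i j ≠ 0, rows i and j span the plane: the Plücker relation for i, j, k, l says that M is
the wedge of these rows divided by M i j. -/
theorem IsDecomposable.exists_wedge {M : Matrix (Fin n) (Fin n) ℂ} (hM : IsDecomposable M) :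
    ∃ ζ η, M = wedge ζ η := by
  by_cases h0 : M = 0
  · exact ⟨0, 0, by ext i j; simp [h0, wedge]⟩
  obtain ⟨i, j, hij⟩ : ∃ i j, M i j ≠ 0 := by
    by_contra! h
    exact h0 (by ext i j; simp [h])
  refine ⟨fun k => M i k, fun l => M j l / M i j, ?_⟩
  ext k l
  have h := hM.2 i j k l
  simp only [wedge, of_apply]
  field_simp
  linear_combination h

theorem mul_wedge_mul_transpose (g : Matrix (Fin n) (Fin n) ℂ) (ζ η : Fin n → ℂ) :
    g * wedge ζ η * gᵀ = wedge (g *ᵥ ζ) (g *ᵥ η) := by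
  simp only [wedge_eq, mul_sub, sub_mul, mul_vecMulVec, vecMulVec_mul, vecMul_transpose]

theorem IsDecomposable.conj {M : Matrix (Fin n) (Fin n) ℂ} (hM : IsDecomposable M)
    (g : Matrix (Fin n) (Fin n) ℂ) : IsDecomposable (g * M * gᵀ) := by
  obtain ⟨ζ, η, rfl⟩ := hM.exists_wedge
  rw [mul_wedge_mul_transpose]
  exact isDecomposable_wedge _ _

theorem IsDecomposable.smul {M : Matrix (Fin n) (Fin n) ℂ} (hM : IsDecomposable M) (c : ℂ) :
    IsDecomposable (c • M) := by
  refine ⟨by rw [transpose_smul, hM.1, smul_neg], fun i j k l => ?_⟩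
  simp only [Matrix.smul_apply, smul_eq_mul]
  linear_combination c ^ 2 * hM.2 i j k l

theorem isoForm_smul (R : Tensor4 n) (c : ℂ) (M : Matrix (Fin n) (Fin n) ℂ) :
    isoForm R (c • M) = ‖c‖ ^ 2 * isoForm R M := by
  have h1 : c * (star c * herm R M M) = ((‖c‖ ^ 2 : ℝ) : ℂ) * herm R M M := by
    rw [← mul_assoc]
    congr 1
    rw [Complex.star_def, Complex.mul_conj, Complex.normSq_eq_norm_sq]
  rw [isoForm, herm_smul_left, herm_smul_right, h1, Complex.re_ofReal_mul, transpose_smul,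
    Matrix.smul_mul, Matrix.mul_smul, smul_smul, trace_smul, smul_eq_mul, norm_mul, norm_mul,
    isoForm]
  ring

theorem re_herm_comm {R : Tensor4 n} (hR : R ∈ CurvOp n) (X Y : Matrix (Fin n) (Fin n) ℂ) :
    (herm R X Y).re = (herm R Y X).re := by
  rw [← star_herm hR]; simp

theorem continuous_re_herm {T : Type*} [TopologicalSpace T] (R : Tensor4 n)
    {u v : T → Matrix (Fin n) (Fin n) ℂ} (hu : Continuous u) (hv : Continuous v) :
    Continuous fun t => (herm R (u t) (v t)).re := by
  unfold herm
  refine Complex.continuous_re.comp ?_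
  refine continuous_finsetSum _ fun i _ => continuous_finsetSum _ fun j _ =>
    continuous_finsetSum _ fun k _ => continuous_finsetSum _ fun l _ => ?_
  exact (continuous_const.mul (hu.matrix_elem i j)).mul (hv.matrix_elem k l).star

/-! ### Second variation at a zero of the form. -/

/-- The second order Taylor polynomial of `exp (t x)`. -/
noncomputable def expTwo (x : Matrix (Fin n) (Fin n) ℂ) (t : ℂ) : Matrix (Fin n) (Fin n) ℂ :=
  1 + t • x + (t ^ 2 / 2) • (x * x)

theorem expTwo_transpose {x : Matrix (Fin n) (Fin n) ℂ} (hx : xᵀ = -x) (t : ℂ) :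
    (expTwo x t)ᵀ = 1 - t • x + (t ^ 2 / 2) • (x * x) := by
  simp only [expTwo, transpose_add, transpose_smul, transpose_one, transpose_mul, hx, neg_mul_neg,
    smul_neg, sub_eq_add_neg]

/-- The product is (1 + t²x²/2)² − t²x². The truncated exponential is thus orthogonal up to order
t⁴, which is enough for a second variation. -/
theorem expTwo_transpose_mul {x : Matrix (Fin n) (Fin n) ℂ} (hx : xᵀ = -x) (t : ℂ) :
    (expTwo x t)ᵀ * expTwo x t = 1 + t ^ 4 • ((1 / 4 : ℂ) • (x * x * x * x)) := by
  rw [expTwo_transpose hx]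
  simp only [expTwo, add_mul, mul_add, sub_mul, Matrix.smul_mul, Matrix.mul_smul, one_mul,
    mul_one, smul_smul, ← mul_assoc]
  module

theorem exists_expTwo_conj {x : Matrix (Fin n) (Fin n) ℂ} (hx : xᵀ = -x)
    (M : Matrix (Fin n) (Fin n) ℂ) : ∃ N₃ N₄ : Matrix (Fin n) (Fin n) ℂ, ∀ t : ℂ,
      expTwo x t * M * (expTwo x t)ᵀ = M + t • (x * M - M * x) +
        t ^ 2 • ((1 / 2 : ℂ) • (x * x * M) - x * M * x + (1 / 2 : ℂ) • (M * x * x) +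
          t • N₃ + t ^ 2 • N₄) := by
  refine ⟨(1 / 2 : ℂ) • (x * M * x * x) - (1 / 2 : ℂ) • (x * x * M * x),
    (1 / 4 : ℂ) • (x * x * M * x * x), fun t => ?_⟩
  rw [expTwo_transpose hx]
  simp only [expTwo, add_mul, mul_add, mul_sub, Matrix.smul_mul,
    Matrix.mul_smul, one_mul, mul_one, smul_smul, ← mul_assoc]
  module

/-- By cyclicity this trace depends on g only through gᵀg, hence moves at order t⁴. -/
theorem trace_expTwo_conj {x : Matrix (Fin n) (Fin n) ℂ} (hx : xᵀ = -x)
    (M : Matrix (Fin n) (Fin n) ℂ) : ∃ c d : ℂ, ∀ t : ℂ,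
      trace (expTwo x t * M * (expTwo x t)ᵀ * (expTwo x t * M * (expTwo x t)ᵀ)ᵀ) =
        trace (M * Mᵀ) + t ^ 4 * (c + t ^ 4 * d) := by
  have h := expTwo_transpose_mul hx
  generalize (1 / 4 : ℂ) • (x * x * x * x) = Y at h
  refine ⟨trace (M * Y * Mᵀ) + trace (M * Mᵀ * Y), trace (M * Y * Mᵀ * Y), fun t => ?_⟩
  have hg := h t
  generalize expTwo x t = g at hg
  have e1 : trace (g * M * gᵀ * (g * M * gᵀ)ᵀ) = trace (M * (gᵀ * g) * Mᵀ * (gᵀ * g)) := by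
    rw [transpose_mul, transpose_mul, transpose_transpose]
    rw [show g * M * gᵀ * (g * (Mᵀ * gᵀ)) = g * (M * (gᵀ * g) * Mᵀ * gᵀ) by
      simp only [mul_assoc], trace_mul_comm]
    simp only [mul_assoc]
  rw [e1, hg]
  simp only [add_mul, mul_add, Matrix.smul_mul, Matrix.mul_smul, mul_one, trace_add,
    trace_smul, smul_eq_mul]
  ring

theorem re_herm_taylor {R : Tensor4 n} (hR : R ∈ CurvOp n) (M N P : Matrix (Fin n) (Fin n) ℂ)
    (t : ℝ) :
    (herm R (M + (t : ℂ) • N + ((t : ℂ) ^ 2) • P) (M + (t : ℂ) • N + ((t : ℂ) ^ 2) • P)).re =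
      (herm R M M).re + 2 * t * (herm R M N).re +
      t ^ 2 * ((herm R N N).re + 2 * (herm R M P).re) + 2 * t ^ 3 * (herm R N P).re +
      t ^ 4 * (herm R P P).re := by
  have e1 : ∀ (r : ℝ) (z : ℂ), (star (r : ℂ) * z).re = r * z.re := fun r z => by simp
  have e2 : ∀ (r : ℝ) (z : ℂ), ((r : ℂ) * z).re = r * z.re := fun r z => by simp
  have e3 : (t : ℂ) ^ 2 = ((t ^ 2 : ℝ) : ℂ) := by push_cast; ring
  rw [e3]
  simp only [herm_add_left, herm_add_right, herm_smul_left, herm_smul_right, Complex.add_re,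
    e1, e2, re_herm_comm hR N M, re_herm_comm hR P M, re_herm_comm hR P N]
  ring

theorem nonneg_at_zero {G : ℝ → ℝ} (hG : Continuous G) (h : ∀ t, 0 < t → 0 ≤ G t) : 0 ≤ G 0 := by
  have hlim : Filter.Tendsto G (nhdsWithin 0 (Set.Ioi 0)) (nhds (G 0)) :=
    hG.continuousAt.tendsto.mono_left nhdsWithin_le_nhds
  exact ge_of_tendsto hlim (by filter_upwards [self_mem_nhdsWithin] with t ht using h t ht)

/-- If `2ta + t²b(t) + t³c(t) ≥ 0` for all real `t`, with `b` and `c` continuous, then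
`b(0) ≥ 0`. -/
theorem second_coeff_nonneg {a : ℝ} {b c : ℝ → ℝ} (hb : Continuous b) (hc : Continuous c)
    (h : ∀ t : ℝ, 0 ≤ 2 * t * a + t ^ 2 * b t + t ^ 3 * c t) : 0 ≤ b 0 := by
  -- Adding the inequalities at t and −t removes the linear term, so `a` need not be known to
  -- vanish.
  have h1 := nonneg_at_zero (G := fun t => b t + b (-t) + t * (c t - c (-t))) (by fun_prop)
    fun t ht => by
      have h1 := h t
      have h2 := h (-t)
      have h3 : 0 ≤ t ^ 2 * (b t + b (-t) + t * (c t - c (-t))) := by nlinarith [h1, h2]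
      exact nonneg_of_mul_nonneg_right h3 (by positivity)
  simp only [neg_zero, zero_mul, add_zero] at h1
  linarith

/-- The curve g M gᵀ stays decomposable, so the form is nonnegative along it and zero at t = 0. The
triangle inequality bounds the change of the norm term by O(t⁴), which avoids differentiating a norm
that may vanish. -/
theorem second_variation {R : Tensor4 n} (hR : R ∈ CurvOp n)
    (hE : ∀ M, IsDecomposable M → 0 ≤ isoForm R M) {M : Matrix (Fin n) (Fin n) ℂ}
    (hM : IsDecomposable M) (h0 : isoForm R M = 0) {x : Matrix (Fin n) (Fin n) ℂ}
    (hx : xᵀ = -x) :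
    0 ≤ (herm R (x * M - M * x) (x * M - M * x)).re +
      2 * (herm R M ((1 / 2 : ℂ) • (x * x * M) - x * M * x + (1 / 2 : ℂ) • (M * x * x))).re := by
  obtain ⟨N₃, N₄, hconj⟩ := exists_expTwo_conj hx M
  obtain ⟨c, d, htr⟩ := trace_expTwo_conj hx M
  generalize x * M - M * x = N₁ at hconj ⊢
  generalize (1 / 2 : ℂ) • (x * x * M) - x * M * x + (1 / 2 : ℂ) • (M * x * x) = N₂ at hconj ⊢
  obtain ⟨P, hP⟩ : ∃ P : ℝ → Matrix (Fin n) (Fin n) ℂ,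
    P = fun t : ℝ => N₂ + (t : ℂ) • N₃ + ((t : ℂ) ^ 2) • N₄ := ⟨_, rfl⟩
  have hPc : Continuous P := by rw [hP]; fun_prop
  have hP0 : P 0 = N₂ := by simp [hP]
  have b1 := continuous_re_herm R (continuous_const (y := M)) hPc
  have b2 := continuous_re_herm R (continuous_const (y := N₁)) hPc
  have b3 := continuous_re_herm R hPc hPc
  have key := second_coeff_nonneg (a := (herm R M N₁).re)
    (b := fun t => (herm R N₁ N₁).re + 2 * (herm R M (P t)).re)
    (c := fun t => 2 * (herm R N₁ (P t)).re + t * (herm R (P t) (P t)).re +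
      2 * (t * ‖c + (t : ℂ) ^ 4 * d‖)) (by fun_prop) (by fun_prop) ?_
  · simpa only [hP0] using key
  intro t
  have hpos := hE _ (hM.conj (expTwo x t))
  have hPt : N₂ + (t : ℂ) • N₃ + ((t : ℂ) ^ 2) • N₄ = P t := by rw [hP]
  rw [isoForm, htr, hconj, hPt, re_herm_taylor hR] at hpos
  have hnorm : ‖trace (M * Mᵀ) + (t : ℂ) ^ 4 * (c + (t : ℂ) ^ 4 * d)‖ ≤
      ‖trace (M * Mᵀ)‖ + t ^ 4 * ‖c + (t : ℂ) ^ 4 * d‖ := by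
    refine (norm_add_le _ _).trans_eq ?_
    rw [norm_mul, norm_pow, Complex.norm_real, Real.norm_eq_abs, (show Even 4 from ⟨2, rfl⟩).pow_abs]
  rw [isoForm] at h0
  linarith

/-- Replacing x by ix multiplies the first-order term by i, leaving its Hermitian square unchanged,
and negates the second-order term. Adding the two second variations eliminates the latter. -/
theorem herm_commutator_nonneg {R : Tensor4 n} (hR : R ∈ CurvOp n)
    (hE : ∀ M, IsDecomposable M → 0 ≤ isoForm R M) {M : Matrix (Fin n) (Fin n) ℂ}
    (hM : IsDecomposable M) (h0 : isoForm R M = 0) {x : Matrix (Fin n) (Fin n) ℂ}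
    (hx : xᵀ = -x) : 0 ≤ (herm R (x * M - M * x) (x * M - M * x)).re := by
  have h1 := second_variation hR hE hM h0 hx
  have h2 := second_variation hR hE hM h0 (x := Complex.I • x) (by simp [hx])
  set N₁ := x * M - M * x
  set N₂ := (1 / 2 : ℂ) • (x * x * M) - x * M * x + (1 / 2 : ℂ) • (M * x * x)
  have e1 : (Complex.I • x) * M - M * (Complex.I • x) = Complex.I • N₁ := by
    simp only [N₁, Matrix.smul_mul, Matrix.mul_smul, smul_sub]
  have e2 : (1 / 2 : ℂ) • ((Complex.I • x) * (Complex.I • x) * M) -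
      (Complex.I • x) * M * (Complex.I • x) + (1 / 2 : ℂ) • (M * (Complex.I • x) * (Complex.I • x))
      = -N₂ := by
    simp only [N₂, Matrix.smul_mul, Matrix.mul_smul, smul_smul, Complex.I_mul_I, neg_smul, one_smul,
      mul_assoc, smul_neg]
    simp only [← mul_assoc]
    simp
    abel
  rw [e1, e2, herm_neg_right, herm_smul_left, herm_smul_right, ← mul_assoc] at h2
  have e3 : Complex.I * star Complex.I = 1 := by simp
  rw [e3, one_mul, Complex.neg_re] at h2
  linarith

theorem sum2_mul_sum2 (a b : Fin n → Fin n → ℂ) :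
    (∑ i, ∑ j, a i j) * (∑ k, ∑ l, b k l) = ∑ i, ∑ j, ∑ k, ∑ l, a i j * b k l := by
  rw [Finset.sum_mul]
  refine Finset.sum_congr rfl fun i _ => ?_
  rw [Finset.sum_mul]
  refine Finset.sum_congr rfl fun j _ => ?_
  simp only [Finset.mul_sum]

/-- Antisymmetry of M merges the last two terms of Q, so Q(R)(M, M̄) = |R M|² + 4W with W the sum in
`sharp_nonneg`. -/
theorem re_herm_QTensor_nonneg {R : Tensor4 n} (hR : R ∈ CurvOp n)
    (hE : ∀ M, IsDecomposable M → 0 ≤ isoForm R M) {M : Matrix (Fin n) (Fin n) ℂ}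
    (hM : IsDecomposable M) (h0 : isoForm R M = 0) : 0 ≤ (herm (QTensor R) M M).re := by
  have hW := sharp_nonneg hR hM.1 fun Z hZ => herm_commutator_nonneg hR hE hM h0 hZ
  set W := ∑ i, ∑ j, ∑ k, ∑ l, ∑ p, ∑ q,
      (R i p k q : ℂ) * R j p l q * M i j * star (M k l) with hWdef
  have hM' : ∀ i j, M j i = -M i j := fun i j => congrFun (congrFun hM.1 i) j
  let L : Fin n → Fin n → ℂ := fun p q => ∑ i, ∑ j, (R i j p q : ℂ) * M i j
  have hsq : ∑ i, ∑ j, ∑ k, ∑ l, ∑ p, ∑ q, (R i j p q : ℂ) * R k l p q * M i j * star (M k l) =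
      ∑ p, ∑ q, L p q * star (L p q) := by
    have e := sum6_reorder' (fun i j k l p q =>
      (R i j p q : ℂ) * R k l p q * M i j * star (M k l))
    rw [e]
    refine Finset.sum_congr rfl fun p _ => Finset.sum_congr rfl fun q _ => ?_
    simp only [L, star_sum, sum2_mul_sum2]
    refine Finset.sum_congr rfl fun i _ => Finset.sum_congr rfl fun j _ =>
      Finset.sum_congr rfl fun k _ => Finset.sum_congr rfl fun l _ => ?_
    rw [star_mul', star_ofReal]
    ring
  have hQ : herm (QTensor R) M M = ∑ p, ∑ q, L p q * star (L p q) + 2 * W + 2 * W := by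
    have hW' : W = -∑ i, ∑ j, ∑ k, ∑ l, ∑ p, ∑ q,
        (R i p l q : ℂ) * R j p k q * M i j * star (M k l) := by
      rw [hWdef]
      simp only [← Finset.sum_neg_distrib]
      refine Finset.sum_congr rfl fun i _ => Finset.sum_congr rfl fun j _ => ?_
      rw [Finset.sum_comm]
      refine Finset.sum_congr rfl fun k _ => Finset.sum_congr rfl fun l _ =>
        Finset.sum_congr rfl fun p _ => Finset.sum_congr rfl fun q _ => ?_
      rw [hM' k l, star_neg]
      ring
    nth_rewrite 2 [hW']
    rw [← hsq, hWdef]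
    simp only [herm, QTensor, Finset.mul_sum, ← Finset.sum_add_distrib, ← Finset.sum_neg_distrib,
      Complex.ofReal_sum, Finset.sum_mul]
    refine Finset.sum_congr rfl fun i _ => Finset.sum_congr rfl fun j _ =>
      Finset.sum_congr rfl fun k _ => Finset.sum_congr rfl fun l _ =>
      Finset.sum_congr rfl fun p _ => Finset.sum_congr rfl fun q _ => ?_
    push_cast
    ring
  have h1 : 0 ≤ (∑ p, ∑ q, L p q * star (L p q)).re := by
    simp only [Complex.re_sum]
    refine Finset.sum_nonneg fun p _ => Finset.sum_nonneg fun q _ => ?_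
    rw [Complex.star_def, Complex.mul_conj, Complex.ofReal_re]
    exact Complex.normSq_nonneg _
  have e2 : ∀ z : ℂ, (2 * z).re = 2 * z.re := fun z => by simp
  rw [hQ, Complex.add_re, Complex.add_re, e2]
  linarith

/-! ### Positivity of Kulkarni–Nomizu products. -/

open scoped MatrixOrder in
theorem exists_transpose_mul_self {A : Matrix (Fin n) (Fin n) ℝ} (hA : A.PosSemidef) :
    ∃ C : Matrix (Fin n) (Fin n) ℝ, A = Cᵀ * C := by
  obtain ⟨C, hC⟩ := CStarAlgebra.nonneg_iff_eq_star_mul_self.1 hA.nonneg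
  exact ⟨C, by rw [hC, star_eq_conjTranspose, conjTranspose_eq_transpose_of_trivial]⟩

/-- The four terms of the product agree on antisymmetric M. With A = CᵀC and B = DᵀD the value is
4|C M Dᵀ|². -/
theorem re_herm_kn_nonneg {A B : Matrix (Fin n) (Fin n) ℝ} (hA : A.PosSemidef)
    (hB : B.PosSemidef) {M : Matrix (Fin n) (Fin n) ℂ} (hM : Mᵀ = -M) :
    0 ≤ (herm (kn A B) M M).re := by
  obtain ⟨C, hC⟩ := exists_transpose_mul_self hA
  obtain ⟨D, hD⟩ := exists_transpose_mul_self hB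
  have hM' : ∀ i j, M j i = -M i j := fun i j => congrFun (congrFun hM i) j
  let f : Fin n → Fin n → Fin n → Fin n → ℂ := fun i j k l =>
    (A i k : ℂ) * B j l * M i j * star (M k l)
  let N : Fin n → Fin n → ℂ := fun a b => ∑ i, ∑ j, (C a i : ℂ) * D b j * M i j
  have hf : ∑ i, ∑ j, ∑ k, ∑ l, f i j k l = ∑ a, ∑ b, N a b * star (N a b) := by
    simp only [f, hC, hD, mul_apply, transpose_apply, Finset.sum_mul, Finset.mul_sum,
      Complex.ofReal_sum, Complex.ofReal_mul]
    rw [sum6_reorder', Finset.sum_comm]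
    simp only [N, star_sum, sum2_mul_sum2]
    refine Finset.sum_congr rfl fun a _ => ?_
    refine Finset.sum_congr rfl fun b _ => Finset.sum_congr rfl fun i _ =>
      Finset.sum_congr rfl fun j _ => Finset.sum_congr rfl fun k _ =>
      Finset.sum_congr rfl fun l _ => ?_
    simp only [star_mul', star_ofReal]
    ring
  have hsum : herm (kn A B) M M = 4 * ∑ i, ∑ j, ∑ k, ∑ l, f i j k l := by
    have s12 : ∀ g : Fin n → Fin n → Fin n → Fin n → ℂ, ∑ i, ∑ j, ∑ k, ∑ l, g i j k l =
      ∑ i, ∑ j, ∑ k, ∑ l, g j i k l := fun f => Finset.sum_comm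
    have s34 : ∀ g : Fin n → Fin n → Fin n → Fin n → ℂ, ∑ i, ∑ j, ∑ k, ∑ l, g i j k l =
        ∑ i, ∑ j, ∑ k, ∑ l, g i j l k := fun f =>
      Finset.sum_congr rfl fun i _ => Finset.sum_congr rfl fun j _ => Finset.sum_comm
    have h4 : ∀ z : ℂ, 4 * z = z + z + z + z := fun z => by ring
    rw [h4]
    nth_rewrite 2 [s34]
    nth_rewrite 3 [s12]
    nth_rewrite 4 [s12, s34]
    simp only [herm, ← Finset.sum_add_distrib]
    refine Finset.sum_congr rfl fun i _ => Finset.sum_congr rfl fun j _ =>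
      Finset.sum_congr rfl fun k _ => Finset.sum_congr rfl fun l _ => ?_
    simp only [f, kn, hM' i j, hM' k l, star_neg]
    push_cast
    ring
  have e4 : ∀ z : ℂ, (4 * z).re = 4 * z.re := fun z => by simp
  rw [hsum, hf, e4]
  simp only [Complex.re_sum]
  refine mul_nonneg (by norm_num) (Finset.sum_nonneg fun p _ => Finset.sum_nonneg fun q _ => ?_)
  rw [Complex.star_def, Complex.mul_conj, Complex.ofReal_re]
  exact Complex.normSq_nonneg _

/-! ### Evaluation on bivectors built from real vectors. -/

/-- The value `R(u, v, w, z)` on vectors given by their components. -/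
def quad (R : Tensor4 n) (u v w z : Fin n → ℝ) : ℝ :=
  ∑ i, ∑ j, ∑ k, ∑ l, R i j k l * u i * v j * w k * z l

/-- The bivector of two real vectors, as a complex matrix. -/
noncomputable def realWedge (u v : Fin n → ℝ) : Matrix (Fin n) (Fin n) ℂ :=
  wedge (fun i => (u i : ℂ)) (fun i => (v i : ℂ))

theorem herm_realWedge {R : Tensor4 n} (hR : R ∈ CurvOp n) (u v w z : Fin n → ℝ) :
    herm R (realWedge u v) (realWedge w z) = 4 * (quad R u v w z : ℂ) := by
  have h : ∀ a b : Fin n → ℂ, vecMulVec b a = (vecMulVec a b)ᵀ := fun a b => by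
    rw [transpose_vecMulVec]
  simp only [realWedge, wedge_eq]
  rw [h (fun i => (u i : ℂ)), h (fun i => (w i : ℂ)), herm_sub_left, herm_sub_right,
    herm_sub_right, herm_transpose_left hR, herm_transpose_right hR, herm_transpose_left hR,
    herm_transpose_right hR]
  have h2 : herm R (vecMulVec (fun i => (u i : ℂ)) (fun i => (v i : ℂ)))
      (vecMulVec (fun i => (w i : ℂ)) (fun i => (z i : ℂ))) = (quad R u v w z : ℂ) := by
    simp only [herm, quad, vecMulVec_apply, Complex.ofReal_sum]
    refine Finset.sum_congr rfl fun i _ => Finset.sum_congr rfl fun j _ =>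
      Finset.sum_congr rfl fun k _ => Finset.sum_congr rfl fun l _ => ?_
    rw [star_mul', star_ofReal, star_ofReal]
    push_cast
    ring
  rw [h2]
  ring

theorem wedge_complex (u v w z : Fin n → ℝ) :
    wedge (fun i => (u i : ℂ) + Complex.I * v i) (fun i => (w i : ℂ) + Complex.I * z i) =
      (realWedge u w - realWedge v z) + Complex.I • (realWedge u z + realWedge v w) := by
  ext i j
  simp only [wedge, realWedge, of_apply, Matrix.add_apply, Matrix.sub_apply, Matrix.smul_apply,
    smul_eq_mul]
  linear_combination (v i * z j - v j * z i : ℂ) * Complex.I_mul_I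

theorem re_herm_add_I_smul {R : Tensor4 n} (hR : R ∈ CurvOp n)
    (X Y : Matrix (Fin n) (Fin n) ℂ) :
    (herm R (X + Complex.I • Y) (X + Complex.I • Y)).re =
      (herm R X X).re + (herm R Y Y).re - 2 * (herm R Y X).im := by
  have h : (herm R X Y).im = -(herm R Y X).im := by
    rw [← star_herm hR]; simp
  simp only [herm_add_left, herm_add_right, herm_smul_left, herm_smul_right]
  simp [h]
  ring

theorem quad_comm {R : Tensor4 n} (hR : R ∈ CurvOp n) (u v w z : Fin n → ℝ) :
    quad R w z u v = quad R u v w z := by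
  have h1 := herm_realWedge hR u v w z
  have h2 := herm_realWedge hR w z u v
  rw [← star_herm hR, h1] at h2
  have h3 : (4 * quad R u v w z : ℝ) = 4 * quad R w z u v := by
    have := congrArg Complex.re h2
    simpa using this
  linarith

theorem re_herm_wedge_complex {R : Tensor4 n} (hR : R ∈ CurvOp n) (u v w z : Fin n → ℝ) :
    (herm R (wedge (fun i => (u i : ℂ) + Complex.I * v i) (fun i => (w i : ℂ) + Complex.I * z i))
      (wedge (fun i => (u i : ℂ) + Complex.I * v i)
        (fun i => (w i : ℂ) + Complex.I * z i))).re =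
      4 * (quad R u w u w + quad R u z u z + quad R v w v w + quad R v z v z -
        2 * quad R u w v z + 2 * quad R u z v w) := by
  rw [wedge_complex, re_herm_add_I_smul hR]
  simp only [herm_sub_left, herm_sub_right, herm_add_left, herm_add_right, herm_realWedge hR,
    quad_comm hR u w v z, quad_comm hR u z v w]
  simp
  ring

/-- This is twice the bilinear Gram determinant; it vanishes when η is isotropic and orthogonal to
ζ. -/
theorem trace_wedge (ζ η : Fin n → ℂ) : trace (wedge ζ η * (wedge ζ η)ᵀ) =
    2 * ((ζ ⬝ᵥ ζ) * (η ⬝ᵥ η) - (ζ ⬝ᵥ η) ^ 2) := by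
  rw [wedge_eq]
  simp only [transpose_sub, transpose_vecMulVec, sub_mul, mul_sub, vecMulVec_mul_vecMulVec,
    trace_sub, trace_vecMulVec, dotProduct_comm η ζ]
  simp [dotProduct_comm η ζ]
  ring

/-! ### Nonnegativity of the Ricci curvature. -/

/-- At most one summand is negative. Since n ≥ 3 there is an index to pair it with, and all
remaining summands are nonnegative. -/
theorem sum_nonneg_of_pairwise (hn : 3 ≤ n) (c : Fin n → ℝ) (α : Fin n) (hα : c α = 0)
    (h : ∀ β γ, β ≠ γ → β ≠ α → γ ≠ α → 0 ≤ c β + c γ) : 0 ≤ ∑ β, c β := by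
  by_cases hc : ∀ β, 0 ≤ c β
  · exact Finset.sum_nonneg fun β _ => hc β
  push Not at hc
  obtain ⟨β, hβ⟩ := hc
  have hβα : β ≠ α := by rintro rfl; linarith
  obtain ⟨γ, hγ⟩ : ∃ γ, γ ∉ ({α, β} : Finset (Fin n)) := by
    by_contra! hcon
    have h1 : (Finset.univ : Finset (Fin n)) ⊆ {α, β} := fun x _ => hcon x
    have h2 := (Finset.card_le_card h1).trans Finset.card_le_two
    simp at h2
    omega
  simp only [Finset.mem_insert, Finset.mem_singleton, not_or] at hγ
  have hγβ : γ ∈ Finset.univ.erase β := by simp [hγ.2]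
  rw [← Finset.add_sum_erase _ _ (Finset.mem_univ β), ← Finset.add_sum_erase _ _ hγβ, ← add_assoc]
  refine add_nonneg (h β γ (Ne.symm hγ.2) hβα hγ.1) (Finset.sum_nonneg fun δ hδ => ?_)
  simp only [Finset.mem_erase, Finset.mem_univ, and_true] at hδ
  by_cases hδα : δ = α
  · rw [hδα, hα]
  · have := h β δ (Ne.symm hδ.2) hβα hδα
    linarith

theorem quad_self_left {R : Tensor4 n} (hR : R ∈ CurvOp n) (u w z : Fin n → ℝ) :
    quad R u u w z = 0 := by
  have h := herm_realWedge hR u u w z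
  have h0 : realWedge u u = (0 : Matrix (Fin n) (Fin n) ℂ) := by
    ext i j; simp [realWedge, wedge, mul_comm]
  rw [h0] at h
  have h1 : herm R 0 (realWedge w z) = 0 := by simp [herm]
  rw [h1] at h
  have : (quad R u u w z : ℂ) = 0 := by
    rcases mul_eq_zero.1 h.symm with h | h
    · norm_num at h
    · exact h
  exact_mod_cast this

/-- In an orthonormal Ricci eigenbasis f, each eigenvalue is a sum of sectional curvatures K(f_α,
f_β). Testing on f_α ∧ (f_β + i f_γ), whose trace term vanishes, shows K(f_α, f_β) + K(f_α, f_γ) ≥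
0. -/
theorem ric_posSemidef (hn : 3 ≤ n) {R : Tensor4 n} (hR : R ∈ CurvOp n)
    (hE : ∀ M, IsDecomposable M → 0 ≤ isoForm R M) : (ric R).PosSemidef := by
  have hH : (ric R).IsHermitian := by
    rw [Matrix.IsHermitian, conjTranspose_eq_transpose_of_trivial]
    exact ric_isSymm hR
  rw [hH.posSemidef_iff_eigenvalues_nonneg]
  intro α
  let f : Fin n → Fin n → ℝ := fun β => ⇑(hH.eigenvectorBasis β)
  have hcompl : ∀ p q, ∑ β, f β p * f β q = if p = q then 1 else 0 := by
    intro p q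
    have h : (hH.eigenvectorUnitary : Matrix (Fin n) (Fin n) ℝ) *
      star (hH.eigenvectorUnitary : Matrix (Fin n) (Fin n) ℝ) = 1 := Unitary.coe_mul_star_self _
    have := congrFun (congrFun h p) q
    simpa [mul_apply, one_apply, Matrix.IsHermitian.eigenvectorUnitary_apply] using this
  have horth : ∀ β γ, f β ⬝ᵥ f γ = if β = γ then 1 else 0 := by
    intro β γ
    have h := orthonormal_iff_ite.1 hH.eigenvectorBasis.orthonormal γ β
    rw [EuclideanSpace.inner_eq_star_dotProduct] at h
    simpa [f, eq_comm] using h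
  have heig : hH.eigenvalues α = ∑ β, quad R (f α) (f β) (f α) (f β) := by
    rw [hH.eigenvalues_eq α]
    have h1 : ∑ β, quad R (f α) (f β) (f α) (f β) =
        ∑ i, ∑ j, ∑ k, ∑ l, R i j k l * f α i * f α k * ∑ β, f β j * f β l := by
      simp only [quad, Finset.mul_sum]
      rw [Finset.sum_comm]
      refine Finset.sum_congr rfl fun i _ => ?_
      rw [Finset.sum_comm]
      refine Finset.sum_congr rfl fun j _ => ?_
      rw [Finset.sum_comm]
      refine Finset.sum_congr rfl fun k _ => ?_
      rw [Finset.sum_comm]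
      refine Finset.sum_congr rfl fun l _ => Finset.sum_congr rfl fun β _ => ?_
      ring
    rw [h1]
    simp only [hcompl, mul_ite, mul_one, mul_zero, Finset.sum_ite_eq, Finset.mem_univ, if_true]
    simp only [dotProduct, mulVec, ric, of_apply, Finset.mul_sum, Finset.sum_mul, Pi.star_apply,
      star_trivial, RCLike.re_to_real, f]
    refine Finset.sum_congr rfl fun i _ => ?_
    rw [Finset.sum_comm]
    refine Finset.sum_congr rfl fun j _ => Finset.sum_congr rfl fun k _ => ?_
    ring
  rw [Pi.zero_apply, heig]
  refine sum_nonneg_of_pairwise hn _ α (quad_self_left hR _ _ _) fun β γ hβγ hβ hγ => ?_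
  have h := hE _ (isDecomposable_wedge (fun i => (f α i : ℂ) + Complex.I * (0 : Fin n → ℝ) i)
    (fun i => (f β i : ℂ) + Complex.I * f γ i))
  have hz : ∀ u w z : Fin n → ℝ, quad R 0 u w z = 0 := fun u w z => by simp [quad]
  have hz' : ∀ u w z : Fin n → ℝ, quad R u w 0 z = 0 := fun u w z => by simp [quad]
  rw [isoForm, re_herm_wedge_complex hR, trace_wedge] at h
  have e1 : (fun i => (f α i : ℂ) + Complex.I * (0 : Fin n → ℝ) i) = fun i => (f α i : ℂ) := by
    funext i; simp
  have hd : ∀ u v w : Fin n → ℝ, (fun i => (u i : ℂ)) ⬝ᵥ (fun i => (v i : ℂ) + Complex.I * w i) =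
      (u ⬝ᵥ v : ℝ) + Complex.I * (u ⬝ᵥ w : ℝ) := fun u v w => by
    simp only [dotProduct, mul_add, Finset.sum_add_distrib, Complex.ofReal_sum, Finset.mul_sum]
    congr 1
    · exact Finset.sum_congr rfl fun i _ => by push_cast; ring
    · exact Finset.sum_congr rfl fun i _ => by push_cast; ring
  have hd2 : (fun i => (f β i : ℂ) + Complex.I * f γ i) ⬝ᵥ
      (fun i => (f β i : ℂ) + Complex.I * f γ i) = 0 := by
    have e : (fun i => (f β i : ℂ) + Complex.I * f γ i) =
      (fun i => (f β i : ℂ)) + Complex.I • fun i => (f γ i : ℂ) := by funext i; simp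
    nth_rewrite 1 [e]
    rw [add_dotProduct, smul_dotProduct, hd, hd]
    simp [horth, hβγ, hβγ.symm]
  rw [e1, hd2, hd, horth, horth, if_neg hβ.symm, if_neg hγ.symm] at h
  simp only [hz, hz'] at h
  simp at h
  linarith

/-! ### Characterisation of `E` by decomposable bivectors. -/

/-- The complex vector with given real and imaginary parts. -/
noncomputable def toComplex {ι : Type*} (u v : ι → ℝ) : ι → ℂ :=
  fun i => (u i : ℂ) + Complex.I * v i

theorem toComplex_dotProduct {ι : Type*} [Fintype ι] (u v w z : ι → ℝ) :
    toComplex u v ⬝ᵥ toComplex w z =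
      ((u ⬝ᵥ w - v ⬝ᵥ z : ℝ) : ℂ) + Complex.I * ((u ⬝ᵥ z + v ⬝ᵥ w : ℝ) : ℂ) := by
  simp only [dotProduct, toComplex, ← Finset.sum_sub_distrib, ← Finset.sum_add_distrib,
    Complex.ofReal_sum, Finset.mul_sum]
  refine Finset.sum_congr rfl fun i _ => ?_
  push_cast
  linear_combination (v i * z i : ℂ) * Complex.I_mul_I

theorem star_toComplex_dotProduct {ι : Type*} [Fintype ι] (u v w z : ι → ℝ) :
    star (toComplex u v) ⬝ᵥ toComplex w z =
      ((u ⬝ᵥ w + v ⬝ᵥ z : ℝ) : ℂ) + Complex.I * ((u ⬝ᵥ z - v ⬝ᵥ w : ℝ) : ℂ) := by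
  have h : star (toComplex u v) = toComplex u (-v) := by
    funext i
    simp [toComplex]
  rw [h, toComplex_dotProduct, neg_dotProduct, neg_dotProduct, sub_neg_eq_add, sub_eq_add_neg]

theorem toComplex_re_im {ι : Type*} (ζ : ι → ℂ) :
    toComplex (fun i => (ζ i).re) (fun i => (ζ i).im) = ζ := by
  funext i
  rw [toComplex, mul_comm]
  exact Complex.re_add_im _

theorem ofReal_add_I_mul_eq_zero {a b : ℝ} : (a : ℂ) + Complex.I * b = 0 ↔ a = 0 ∧ b = 0 := by
  rw [Complex.ext_iff]; simp

theorem ofReal_add_I_mul_eq_two {a b : ℝ} : (a : ℂ) + Complex.I * b = 2 ↔ a = 2 ∧ b = 0 := by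
  rw [Complex.ext_iff]; simp

theorem quad_bianchi {R : Tensor4 n} (hR : R ∈ CurvOp n) (u v w z : Fin n → ℝ) :
    quad R u w v z - quad R u z v w = quad R u v w z := by
  have e1 : quad R u w v z = ∑ i, ∑ j, ∑ k, ∑ l, R i k j l * u i * v j * w k * z l := by
    simp only [quad]
    refine Finset.sum_congr rfl fun i _ => ?_
    rw [Finset.sum_comm]
    refine Finset.sum_congr rfl fun j _ => Finset.sum_congr rfl fun k _ =>
      Finset.sum_congr rfl fun l _ => by ring
  have e2 : quad R u z v w = ∑ i, ∑ j, ∑ k, ∑ l, R i l j k * u i * v j * w k * z l := by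
    simp only [quad]
    refine Finset.sum_congr rfl fun i _ => ?_
    rw [Finset.sum_comm]
    refine Finset.sum_congr rfl fun j _ => ?_
    rw [Finset.sum_comm]
    refine Finset.sum_congr rfl fun k _ => Finset.sum_congr rfl fun l _ => by ring
  rw [e1, e2, quad]
  simp only [← Finset.sum_sub_distrib]
  refine Finset.sum_congr rfl fun i _ => Finset.sum_congr rfl fun j _ =>
    Finset.sum_congr rfl fun k _ => Finset.sum_congr rfl fun l _ => ?_
  have h1 := hR.2.2 i j k l
  have h2 := antisymm_right hR i k j l
  linear_combination (u i * v j * w k * z l) * (-h1 + h2)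

theorem inner_prodPlane (e f : ProdPlane n) :
    inner ℝ e f = (e.fst : Fin n → ℝ) ⬝ᵥ f.fst + (e.snd : Fin 2 → ℝ) ⬝ᵥ f.snd := by
  rw [WithLp.prod_inner_apply, EuclideanSpace.inner_eq_star_dotProduct,
    EuclideanSpace.inner_eq_star_dotProduct]
  congr 1 <;> · rw [dotProduct_comm, star_trivial]; rfl

/-- The combination of curvatures in the definition of nonnegative isotropic curvature. -/
def isoExpr {V : Type*} (T : V → V → V → V → ℝ) (e₁ e₂ e₃ e₄ : V) : ℝ :=
  T e₁ e₃ e₁ e₃ + T e₁ e₄ e₁ e₄ + T e₂ e₃ e₂ e₃ + T e₂ e₄ e₂ e₄ - 2 * T e₁ e₂ e₃ e₄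

/-- The complexification of the `ℝⁿ` components. -/
noncomputable def cfst (e f : ProdPlane n) : Fin n → ℂ := toComplex e.fst f.fst

/-- The complexification of the `ℝ²` components. -/
noncomputable def csnd (e f : ProdPlane n) : Fin 2 → ℂ := toComplex e.snd f.snd

theorem bilin_eq_inner (e₁ e₂ e₃ e₄ : ProdPlane n) :
    cfst e₁ e₂ ⬝ᵥ cfst e₃ e₄ + csnd e₁ e₂ ⬝ᵥ csnd e₃ e₄ =
      ((inner ℝ e₁ e₃ - inner ℝ e₂ e₄ : ℝ) : ℂ) +
        Complex.I * ((inner ℝ e₁ e₄ + inner ℝ e₂ e₃ : ℝ) : ℂ) := by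
  simp only [cfst, csnd, toComplex_dotProduct, inner_prodPlane]
  push_cast
  ring

theorem herm_eq_inner (e₁ e₂ e₃ e₄ : ProdPlane n) :
    star (cfst e₁ e₂) ⬝ᵥ cfst e₃ e₄ + star (csnd e₁ e₂) ⬝ᵥ csnd e₃ e₄ =
      ((inner ℝ e₁ e₃ + inner ℝ e₂ e₄ : ℝ) : ℂ) +
        Complex.I * ((inner ℝ e₁ e₄ - inner ℝ e₂ e₃ : ℝ) : ℂ) := by
  simp only [cfst, csnd, star_toComplex_dotProduct, inner_prodPlane]
  push_cast
  ring

/-- The Bianchi identity converts the mixed terms of R(M, M̄) into the isotropic curvature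
combination. Isotropy makes the Gram matrix of the ℂ² parts z, w minus that of the ℂⁿ parts, so tr(M
Mᵀ) = 2(z₀w₁ − z₁w₀)², whose modulus is twice the sphere term. Only the bilinear relations are
needed, not orthonormality. -/
theorem four_mul_isoExpr (R : CurvOp n) (e₁ e₂ e₃ e₄ : ProdPlane n)
    (h11 : cfst e₁ e₂ ⬝ᵥ cfst e₁ e₂ + csnd e₁ e₂ ⬝ᵥ csnd e₁ e₂ = 0)
    (h12 : cfst e₁ e₂ ⬝ᵥ cfst e₃ e₄ + csnd e₁ e₂ ⬝ᵥ csnd e₃ e₄ = 0)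
    (h22 : cfst e₃ e₄ ⬝ᵥ cfst e₃ e₄ + csnd e₃ e₄ ⬝ᵥ csnd e₃ e₄ = 0) :
    4 * isoExpr (inducedS R) e₁ e₂ e₃ e₄ = isoForm R.1 (wedge (cfst e₁ e₂) (cfst e₃ e₄)) := by
  have hS : ∀ a b c d : ProdPlane n, inducedS R a b c d = quad R.1 a.fst b.fst c.fst d.fst +
      ((a.snd : Fin 2 → ℝ) ⬝ᵥ c.snd) * ((b.snd : Fin 2 → ℝ) ⬝ᵥ d.snd) -
      ((a.snd : Fin 2 → ℝ) ⬝ᵥ d.snd) * ((b.snd : Fin 2 → ℝ) ⬝ᵥ c.snd) := fun a b c d => by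
    have hi : ∀ x y : EuclideanSpace ℝ (Fin 2), inner ℝ x y = (x : Fin 2 → ℝ) ⬝ᵥ y :=
      fun x y => by
        rw [EuclideanSpace.inner_eq_star_dotProduct, dotProduct_comm]; simp
    simp only [inducedS, hi]
    rfl
  have htr : ‖trace (wedge (cfst e₁ e₂) (cfst e₃ e₄) * (wedge (cfst e₁ e₂) (cfst e₃ e₄))ᵀ)‖ =
      2 * Complex.normSq (csnd e₁ e₂ 0 * csnd e₃ e₄ 1 - csnd e₁ e₂ 1 * csnd e₃ e₄ 0) := by
    have : trace (wedge (cfst e₁ e₂) (cfst e₃ e₄) * (wedge (cfst e₁ e₂) (cfst e₃ e₄))ᵀ) =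
        2 * (csnd e₁ e₂ 0 * csnd e₃ e₄ 1 - csnd e₁ e₂ 1 * csnd e₃ e₄ 0) ^ 2 := by
      rw [trace_wedge, eq_neg_of_add_eq_zero_left h11, eq_neg_of_add_eq_zero_left h12,
        eq_neg_of_add_eq_zero_left h22]
      simp only [dotProduct, Fin.sum_univ_two]
      ring
    rw [this, norm_mul, norm_pow, Complex.normSq_eq_norm_sq]
    simp
  have hmain : (herm R.1 (wedge (cfst e₁ e₂) (cfst e₃ e₄)) (wedge (cfst e₁ e₂) (cfst e₃ e₄))).re =
    _ := re_herm_wedge_complex R.2 e₁.fst e₂.fst e₃.fst e₄.fst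
  rw [isoForm, hmain, htr, isoExpr, hS, hS, hS, hS, hS,
    ← quad_bianchi R.2 e₁.fst e₂.fst e₃.fst e₄.fst]
  simp only [csnd, toComplex, Complex.normSq_apply, dotProduct, Fin.sum_univ_two]
  simp
  ring

theorem orthonormal_four {V : Type*} [NormedAddCommGroup V] [InnerProductSpace ℝ V]
    {e₁ e₂ e₃ e₄ : V} :
    Orthonormal ℝ ![e₁, e₂, e₃, e₄] ↔ (inner ℝ e₁ e₁ = (1 : ℝ) ∧ inner ℝ e₂ e₂ = (1 : ℝ) ∧
      inner ℝ e₃ e₃ = (1 : ℝ) ∧ inner ℝ e₄ e₄ = (1 : ℝ)) ∧ inner ℝ e₁ e₂ = (0 : ℝ) ∧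
      inner ℝ e₁ e₃ = (0 : ℝ) ∧ inner ℝ e₁ e₄ = (0 : ℝ) ∧ inner ℝ e₂ e₃ = (0 : ℝ) ∧
      inner ℝ e₂ e₄ = (0 : ℝ) ∧ inner ℝ e₃ e₄ = (0 : ℝ) := by
  rw [orthonormal_iff_ite]
  constructor
  · intro h
    refine ⟨⟨?_, ?_, ?_, ?_⟩, ?_, ?_, ?_, ?_, ?_, ?_⟩
    · simpa using h 0 0
    · simpa using h 1 1
    · simpa using h 2 2
    · simpa using h 3 3
    · simpa using h 0 1
    · simpa using h 0 2
    · simpa using h 0 3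
    · simpa using h 1 2
    · simpa using h 1 3
    · simpa using h 2 3
  · rintro ⟨⟨h1, h2, h3, h4⟩, h12, h13, h14, h23, h24, h34⟩ i j
    have h21 := (real_inner_comm e₂ e₁).symm.trans h12
    have h31 := (real_inner_comm e₃ e₁).symm.trans h13
    have h41 := (real_inner_comm e₄ e₁).symm.trans h14
    have h32 := (real_inner_comm e₃ e₂).symm.trans h23
    have h42 := (real_inner_comm e₄ e₂).symm.trans h24
    have h43 := (real_inner_comm e₄ e₃).symm.trans h34
    fin_cases i <;> fin_cases j <;>
      first
        | simpa using h1
        | simpa using h2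
        | simpa using h3
        | simpa using h4
        | (simp; assumption)

theorem mem_E_of_isoForm_nonneg {R : CurvOp n}
    (h : ∀ M, IsDecomposable M → 0 ≤ isoForm R.1 M) : R ∈ E n := by
  intro e₁ e₂ e₃ e₄ he
  obtain ⟨⟨h1, h2, h3, h4⟩, h12, h13, h14, h23, h24, h34⟩ := orthonormal_four.1 he
  have h21 := (real_inner_comm e₂ e₁).symm.trans h12
  have h43 := (real_inner_comm e₄ e₃).symm.trans h34
  have := four_mul_isoExpr R e₁ e₂ e₃ e₄ (by rw [bilin_eq_inner, h1, h2, h12, h21]; simp)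
    (by rw [bilin_eq_inner, h13, h24, h14, h23]; simp)
    (by rw [bilin_eq_inner, h3, h4, h34, h43]; simp)
  have hpos := h _ (isDecomposable_wedge (cfst e₁ e₂) (cfst e₃ e₄))
  change 0 ≤ isoExpr (inducedS R) e₁ e₂ e₃ e₄
  linarith

/-- Complex square roots allow a triangular solution when p or r is nonzero. This is why the flat
directions of an ℝ² factor suffice to make any pair isotropic. -/
theorem exists_gram_two (p q r : ℂ) :
    ∃ z w : Fin 2 → ℂ, z ⬝ᵥ z = p ∧ z ⬝ᵥ w = q ∧ w ⬝ᵥ w = r := by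
  have hs : ∀ x : ℂ, ∃ y, y * y = x := fun x => by
    obtain ⟨y, hy⟩ := IsAlgClosed.exists_pow_nat_eq x (n := 2) (by norm_num)
    exact ⟨y, by rw [← hy, sq]⟩
  have aux : ∀ p q r : ℂ, p ≠ 0 → ∃ z w : Fin 2 → ℂ, z ⬝ᵥ z = p ∧ z ⬝ᵥ w = q ∧ w ⬝ᵥ w = r := by
    intro p q r hp
    obtain ⟨s, hs1⟩ := hs p
    have hs0 : s ≠ 0 := by rintro rfl; exact hp (by rw [← hs1, zero_mul])
    obtain ⟨t, ht⟩ := hs (r - (q / s) * (q / s))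
    refine ⟨![s, 0], ![q / s, t], ?_, ?_, ?_⟩ <;>
      simp only [dotProduct, Fin.sum_univ_two, cons_val_zero, cons_val_one]
    · rw [hs1]; ring
    · field_simp; ring
    · rw [ht]; ring
  by_cases hp : p = 0
  · by_cases hr : r = 0
    -- When both diagonal entries vanish, the two isotropic lines of ℂ² are used, scaled to have
    -- product q.
    · refine ⟨![1, Complex.I], ![q / 2, -(q / 2) * Complex.I], ?_, ?_, ?_⟩ <;>
        simp only [dotProduct, Fin.sum_univ_two, cons_val_zero, cons_val_one]
      · rw [hp]; simp
      · linear_combination (-(q / 2)) * Complex.I_mul_I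
      · rw [hr]; linear_combination (q / 2 * (q / 2)) * Complex.I_mul_I
    · obtain ⟨w, z, h1, h2, h3⟩ := aux r q p hr
      exact ⟨z, w, h3, by rw [dotProduct_comm, h2], h1⟩
  · exact aux p q r hp

/-- The vector of `ℝⁿ × ℝ²` with given components. -/
noncomputable def mkPlane (u : Fin n → ℝ) (x : Fin 2 → ℝ) : ProdPlane n :=
  WithLp.toLp 2 (WithLp.toLp 2 u, WithLp.toLp 2 x)

/-- The bilinear and Hermitian relations together say that the real and imaginary parts form an
orthonormal four-frame. The value 2 is |e₁ + i e₂|². -/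
theorem isoForm_nonneg_of_unitary {R : CurvOp n} (hR : R ∈ E n) (ζ η : Fin n → ℂ)
    (z w : Fin 2 → ℂ) (h11 : ζ ⬝ᵥ ζ + z ⬝ᵥ z = 0) (h12 : ζ ⬝ᵥ η + z ⬝ᵥ w = 0)
    (h22 : η ⬝ᵥ η + w ⬝ᵥ w = 0) (g11 : star ζ ⬝ᵥ ζ + star z ⬝ᵥ z = 2)
    (g12 : star ζ ⬝ᵥ η + star z ⬝ᵥ w = 0) (g22 : star η ⬝ᵥ η + star w ⬝ᵥ w = 2) :
    0 ≤ isoForm R.1 (wedge ζ η) := by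
  obtain ⟨e₁, e₂, rfl, rfl⟩ : ∃ e₁ e₂ : ProdPlane n, cfst e₁ e₂ = ζ ∧ csnd e₁ e₂ = z :=
    ⟨mkPlane (fun i => (ζ i).re) (fun i => (z i).re),
      mkPlane (fun i => (ζ i).im) (fun i => (z i).im), toComplex_re_im ζ, toComplex_re_im z⟩
  obtain ⟨e₃, e₄, rfl, rfl⟩ : ∃ e₁ e₂ : ProdPlane n, cfst e₁ e₂ = η ∧ csnd e₁ e₂ = w :=
    ⟨mkPlane (fun i => (η i).re) (fun i => (w i).re),
      mkPlane (fun i => (η i).im) (fun i => (w i).im), toComplex_re_im η, toComplex_re_im w⟩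
  rw [← four_mul_isoExpr R e₁ e₂ e₃ e₄ h11 h12 h22]
  rw [bilin_eq_inner, ofReal_add_I_mul_eq_zero] at h11 h12 h22
  rw [herm_eq_inner] at g11 g12 g22
  rw [ofReal_add_I_mul_eq_zero] at g12
  rw [ofReal_add_I_mul_eq_two] at g11 g22
  have c1 := real_inner_comm e₁ e₂
  have c2 := real_inner_comm e₃ e₄
  have := hR e₁ e₂ e₃ e₄ (orthonormal_four.2 ⟨⟨by linarith, by linarith, by linarith, by linarith⟩,
    by linarith, by linarith, by linarith, by linarith, by linarith, by linarith⟩)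
  change 0 ≤ isoExpr (inducedS R) e₁ e₂ e₃ e₄ at this
  linarith

theorem wedge_smul_smul (a b : ℂ) (ζ η : Fin n → ℂ) :
    wedge (a • ζ) (b • η) = (a * b) • wedge ζ η := by
  ext i j; simp [wedge]; ring

theorem wedge_sub_smul (b : ℂ) (ζ η : Fin n → ℂ) : wedge ζ (η - b • ζ) = wedge ζ η := by
  ext i j; simp [wedge]; ring

theorem exists_pos_star_dotProduct (ζ : Fin n → ℂ) (z : Fin 2 → ℂ) (h : ζ ≠ 0) :
    ∃ r : ℝ, 0 < r ∧ star ζ ⬝ᵥ ζ + star z ⬝ᵥ z = (r : ℂ) ^ 2 := by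
  have hs : ∀ {ι : Type} [Fintype ι] (u : ι → ℂ),
      star u ⬝ᵥ u = ((∑ i, Complex.normSq (u i) : ℝ) : ℂ) := fun u => by
    simp only [dotProduct, Pi.star_apply, Complex.ofReal_sum]
    refine Finset.sum_congr rfl fun i _ => ?_
    rw [Complex.star_def, mul_comm, Complex.mul_conj]
  obtain ⟨i, hi⟩ := Function.ne_iff.1 h
  have hpos : 0 < ∑ i, Complex.normSq (ζ i) + ∑ i, Complex.normSq (z i) :=
    add_pos_of_pos_of_nonneg (Finset.sum_pos' (fun i _ => Complex.normSq_nonneg _)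
      ⟨i, Finset.mem_univ _, Complex.normSq_pos.2 hi⟩)
      (Finset.sum_nonneg fun i _ => Complex.normSq_nonneg _)
  refine ⟨Real.sqrt _, Real.sqrt_pos.2 hpos, ?_⟩
  rw [← Complex.ofReal_pow, Real.sq_sqrt hpos.le, hs, hs]
  push_cast
  rfl

/-- After lifting ζ, η to an isotropic pair, Hermitian Gram–Schmidt stays inside the plane they
span, which remains isotropic, and changes ζ ∧ η only by a nonzero scalar. The form is homogeneous
under scalars. -/
theorem isoForm_nonneg_of_mem_E {R : CurvOp n} (hR : R ∈ E n) {M : Matrix (Fin n) (Fin n) ℂ}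
    (hM : IsDecomposable M) : 0 ≤ isoForm R.1 M := by
  obtain ⟨ζ, η, rfl⟩ := hM.exists_wedge
  by_cases h0 : wedge ζ η = 0
  · rw [h0, ← zero_smul ℂ (0 : Matrix (Fin n) (Fin n) ℂ), isoForm_smul]
    simp
  obtain ⟨z, w, hz, hzw, hw⟩ := exists_gram_two (-(ζ ⬝ᵥ ζ)) (-(ζ ⬝ᵥ η)) (-(η ⬝ᵥ η))
  have hζ : ζ ≠ 0 := by
    rintro rfl
    exact h0 (by ext i j; simp [wedge])
  obtain ⟨r, hr, hr2⟩ := exists_pos_star_dotProduct ζ z hζ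
  have hrC : (r : ℂ) ≠ 0 := by exact_mod_cast hr.ne'
  obtain ⟨b, hb⟩ : ∃ b : ℂ, b * (r : ℂ) ^ 2 = star ζ ⬝ᵥ η + star z ⬝ᵥ w :=
    ⟨(star ζ ⬝ᵥ η + star z ⬝ᵥ w) / (r : ℂ) ^ 2, by field_simp⟩
  rw [← wedge_sub_smul b] at h0 ⊢
  have hη : η - b • ζ ≠ 0 := by
    intro h
    rw [h] at h0
    exact h0 (by ext i j; simp [wedge])
  obtain ⟨s, hs, hs2⟩ := exists_pos_star_dotProduct (η - b • ζ) (w - b • z) hη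
  have hsC : (s : ℂ) ≠ 0 := by exact_mod_cast hs.ne'
  have k11 : ζ ⬝ᵥ ζ + z ⬝ᵥ z = 0 := by rw [hz]; ring
  have k12 : ζ ⬝ᵥ (η - b • ζ) + z ⬝ᵥ (w - b • z) = 0 := by
    simp only [dotProduct_sub, dotProduct_smul, smul_eq_mul, hz, hzw]; ring
  have k22 : (η - b • ζ) ⬝ᵥ (η - b • ζ) + (w - b • z) ⬝ᵥ (w - b • z) = 0 := by
    simp only [dotProduct_sub, sub_dotProduct, smul_dotProduct, dotProduct_smul, smul_eq_mul, hz,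
      hzw, hw, dotProduct_comm η ζ, dotProduct_comm w z]
    ring
  have l12 : star ζ ⬝ᵥ (η - b • ζ) + star z ⬝ᵥ (w - b • z) = 0 := by
    simp only [dotProduct_sub, dotProduct_smul, smul_eq_mul]
    linear_combination -hb - b * hr2
  generalize η - b • ζ = η' at *
  generalize w - b • z = w' at *
  have h2 : ((Real.sqrt 2 : ℝ) : ℂ) * (Real.sqrt 2 : ℝ) = 2 := by
    rw [← Complex.ofReal_mul, Real.mul_self_sqrt (by norm_num)]; norm_num
  have hc : ∀ c : ℝ, star (c : ℂ) = c := star_ofReal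
  have hu := isoForm_nonneg_of_unitary hR (((Real.sqrt 2 / r : ℝ) : ℂ) • ζ)
    (((Real.sqrt 2 / s : ℝ) : ℂ) • η') (((Real.sqrt 2 / r : ℝ) : ℂ) • z)
    (((Real.sqrt 2 / s : ℝ) : ℂ) • w')
    (by simp only [smul_dotProduct, dotProduct_smul, ← smul_add, k11, smul_zero])
    (by simp only [smul_dotProduct, dotProduct_smul, ← smul_add, k12, smul_zero])
    (by simp only [smul_dotProduct, dotProduct_smul, ← smul_add, k22, smul_zero])
    (by
      simp only [star_smul, smul_dotProduct, dotProduct_smul, hc, smul_eq_mul]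
      push_cast
      field_simp
      linear_combination (r : ℂ) ^ 2 * h2 + (Real.sqrt 2 : ℂ) ^ 2 * hr2)
    (by simp only [star_smul, smul_dotProduct, dotProduct_smul, ← smul_add, l12, smul_zero])
    (by
      simp only [star_smul, smul_dotProduct, dotProduct_smul, hc, smul_eq_mul]
      push_cast
      field_simp
      linear_combination (s : ℂ) ^ 2 * h2 + (Real.sqrt 2 : ℂ) ^ 2 * hs2)
  rw [wedge_smul_smul, isoForm_smul] at hu
  refine nonneg_of_mul_nonneg_right hu ?_
  rw [← Complex.ofReal_mul, Complex.norm_real]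
  have : 0 < Real.sqrt 2 / r * (Real.sqrt 2 / s) := by positivity
  exact pow_pos (norm_pos_iff.2 this.ne') 2

theorem mem_E_iff {R : CurvOp n} : R ∈ E n ↔ ∀ M, IsDecomposable M → 0 ≤ isoForm R.1 M :=
  ⟨fun h _ hM => isoForm_nonneg_of_mem_E h hM, mem_E_of_isoForm_nonneg⟩

/-! ### How Q transforms under ℓ_{a,b}. -/

/-- The contraction `∑ Rᵢₚₖq Aₚq`. -/
def contract (R : Tensor4 n) (A : Matrix (Fin n) (Fin n) ℝ) : Matrix (Fin n) (Fin n) ℝ :=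
  of fun i k => ∑ p, ∑ q, R i p k q * A p q

/-- The polarization of `Q`. -/
def crossQ (R T : Tensor4 n) : Tensor4 n := fun i j k l =>
  ∑ p, ∑ q, (R i j p q * T k l p q + T i j p q * R k l p q +
    2 * (R i p k q * T j p l q + R j p l q * T i p k q) -
    2 * (R i p l q * T j p k q + R j p k q * T i p l q))

theorem QTensor_add (R T : Tensor4 n) :
    QTensor (R + T) = QTensor R + crossQ R T + QTensor T := by
  funext i j k l
  simp only [QTensor, crossQ, Pi.add_apply, ← Finset.sum_add_distrib]
  refine Finset.sum_congr rfl fun p _ => Finset.sum_congr rfl fun q _ => ?_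
  ring

theorem crossQ_self (T : Tensor4 n) : crossQ T T = 2 • QTensor T := by
  funext i j k l
  simp only [QTensor, crossQ, Pi.smul_apply, nsmul_eq_mul, Finset.mul_sum]
  refine Finset.sum_congr rfl fun p _ => Finset.sum_congr rfl fun q _ => ?_
  push_cast
  ring

theorem crossQ_kn_one {R : Tensor4 n} (hR : R ∈ CurvOp n) {A : Matrix (Fin n) (Fin n) ℝ}
    (hA : A.IsSymm) :
    crossQ R (kn A 1) = (2 : ℝ) • kn (ric R) A + (2 : ℝ) • kn (contract R A) 1 := by
  have hA' : ∀ i j, A j i = A i j := fun i j => hA.apply i j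
  have t1 : ∀ i j k l, ∑ p, ∑ q, R i j p q * kn A 1 k l p q =
      ∑ p, (2 * A k p * R i j p l - 2 * A l p * R i j p k) := by
    intro i j k l
    have e : ∑ p, ∑ q, R i j p q * kn A 1 k l p q =
        ∑ p, R i j p l * A k p - ∑ q, R i j l q * A k q - ∑ p, R i j p k * A l p +
          ∑ q, R i j k q * A l q := by
      simp only [kn, mul_add, mul_sub, Finset.sum_add_distrib, Finset.sum_sub_distrib, one_apply,
        mul_ite, mul_one, mul_zero, Finset.sum_ite_eq, Finset.mem_univ, if_true]
      simp only [Finset.sum_ite_irrel, Finset.sum_const_zero, Finset.sum_ite_eq, Finset.mem_univ,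
        if_true]
    rw [e]
    simp only [← Finset.sum_add_distrib, ← Finset.sum_sub_distrib]
    refine Finset.sum_congr rfl fun p _ => ?_
    rw [antisymm_right hR i j p l, antisymm_right hR i j p k]
    ring
  have t3 : ∀ i j k l, ∑ p, ∑ q, R i p k q * kn A 1 j p l q =
      ric R i k * A j l + (1 : Matrix (Fin n) (Fin n) ℝ) j l * contract R A i k -
        ∑ p, (R i l k p * A j p + R i p k j * A l p) := by
    intro i j k l
    have e : ∑ p, ∑ q, R i p k q * kn A 1 j p l q =
        ∑ p, R i p k p * A j l - ∑ q, R i l k q * A j q - ∑ p, R i p k j * A p l +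
          (1 : Matrix (Fin n) (Fin n) ℝ) j l * ∑ p, ∑ q, R i p k q * A p q := by
      simp only [kn, mul_add, mul_sub, Finset.sum_add_distrib, Finset.sum_sub_distrib, one_apply,
        mul_ite, mul_one, mul_zero, Finset.sum_ite_eq, Finset.mem_univ, if_true]
      simp only [Finset.sum_ite_irrel, Finset.sum_const_zero, Finset.sum_ite_eq',
        Finset.mem_univ, if_true, ite_mul, one_mul, zero_mul]
    rw [e]
    simp only [ric, contract, of_apply, Finset.sum_mul, Finset.sum_add_distrib]
    have e2 : ∑ p, R i p k j * A p l = ∑ p, R i p k j * A l p :=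
      Finset.sum_congr rfl fun p _ => by rw [hA' l p]
    rw [e2]
    ring
  funext i j k l
  have hsplit : crossQ R (kn A 1) i j k l =
      ∑ p, ∑ q, R i j p q * kn A 1 k l p q + ∑ p, ∑ q, R k l p q * kn A 1 i j p q +
      2 * (∑ p, ∑ q, R i p k q * kn A 1 j p l q + ∑ p, ∑ q, R j p l q * kn A 1 i p k q) -
      2 * (∑ p, ∑ q, R i p l q * kn A 1 j p k q + ∑ p, ∑ q, R j p k q * kn A 1 i p l q) := by
    simp only [crossQ, Finset.mul_sum, ← Finset.sum_add_distrib, ← Finset.sum_sub_distrib]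
    refine Finset.sum_congr rfl fun p _ => Finset.sum_congr rfl fun q _ => ?_
    ring
  rw [hsplit, t1, t1, t3, t3, t3, t3]
  -- What remains beyond the Ricci and contraction terms cancels for each p: every coefficient of an
  -- entry of A is a Bianchi sum.
  have hrest : ∑ p, (2 * A k p * R i j p l - 2 * A l p * R i j p k) +
      ∑ p, (2 * A i p * R k l p j - 2 * A j p * R k l p i) -
      2 * (∑ p, (R i l k p * A j p + R i p k j * A l p) +
        ∑ p, (R j k l p * A i p + R j p l i * A k p)) +
      2 * (∑ p, (R i k l p * A j p + R i p l j * A k p) +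
        ∑ p, (R j l k p * A i p + R j p k i * A l p)) = 0 := by
    simp only [Finset.mul_sum, ← Finset.sum_add_distrib, ← Finset.sum_sub_distrib]
    refine Finset.sum_eq_zero fun p _ => ?_
    have b1 := hR.2.2 i p k l
    have b2 := hR.2.2 j p k l
    have b3 := hR.2.2 i j p l
    have b4 := hR.2.2 i j p k
    have f1 : R k l p i = -R i p k l := by rw [hR.2.1 p i k l, hR.1 i p k l]
    have f2 := antisymm_right hR i l p k
    have f3 : R k l p j = -R j p k l := by rw [hR.2.1 p j k l, hR.1 j p k l]
    have f4 := antisymm_right hR j l p k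
    have f5 : R j p l i = -R i l j p := by rw [hR.2.1 l i j p, hR.1 i l j p]
    have f6 : R j p k i = -R i k j p := by rw [hR.2.1 k i j p, hR.1 i k j p]
    rw [f1, f2, f3, f4, f5, f6]
    linear_combination 2 * A j p * b1 - 2 * A i p * b2 + 2 * A k p * b3 - 2 * A l p * b4
  simp only [Pi.add_apply, Pi.smul_apply, smul_eq_mul, kn]
  linear_combination hrest

theorem ric_kn (A B : Matrix (Fin n) (Fin n) ℝ) :
    ric (kn A B) = B.trace • A - A * B - B * A + A.trace • B := by
  ext i k
  simp only [ric, kn, of_apply, Matrix.add_apply, Matrix.sub_apply, Matrix.smul_apply, mul_apply,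
    trace, diag_apply, smul_eq_mul, Finset.sum_add_distrib, Finset.sum_sub_distrib,
    Finset.sum_mul]
  congr 1
  congr 1
  · congr 1
    exact Finset.sum_congr rfl fun p _ => mul_comm _ _
  · exact Finset.sum_congr rfl fun p _ => mul_comm _ _

theorem contract_kn_one {A : Matrix (Fin n) (Fin n) ℝ} (hA : A.IsSymm) :
    contract (kn A 1) A = A.trace • A - (2 : ℝ) • (A * A) + (A * A).trace • 1 := by
  have hA' : ∀ i j, A j i = A i j := fun i j => hA.apply i j
  ext i k
  have e : contract (kn A 1) A i k = ∑ p, A i k * A p p - ∑ q, A i q * A k q - ∑ p, A p k * A p i +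
      (1 : Matrix (Fin n) (Fin n) ℝ) i k * ∑ p, ∑ q, A p q * A p q := by
    simp only [contract, of_apply, kn, add_mul, sub_mul, Finset.sum_add_distrib,
      Finset.sum_sub_distrib, one_apply, mul_ite, mul_one, mul_zero, ite_mul, zero_mul]
    simp only [Finset.sum_ite_irrel, Finset.sum_const_zero, Finset.sum_ite_eq,
      Finset.sum_ite_eq', Finset.mem_univ, if_true, one_mul]
  rw [e]
  simp only [Matrix.add_apply, Matrix.sub_apply, Matrix.smul_apply, mul_apply,
    trace, diag_apply, smul_eq_mul, Finset.sum_mul, two_mul]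
  have e1 : ∑ q, A i q * A k q = ∑ q, A i q * A q k :=
    Finset.sum_congr rfl fun q _ => by rw [hA' k q]
  have e2 : ∑ p, A p k * A p i = ∑ p, A i p * A p k :=
    Finset.sum_congr rfl fun p _ => by rw [hA' i p, mul_comm]
  have e3 : ∑ p, ∑ q, A p q * A p q = ∑ p, ∑ q, A p q * A q p :=
    Finset.sum_congr rfl fun p _ => Finset.sum_congr rfl fun q _ => by rw [hA' p q]
  have e4 : ∑ p, A i k * A p p = ∑ p, A p p * A i k :=
    Finset.sum_congr rfl fun p _ => mul_comm _ _
  rw [e1, e2, e3, e4]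
  simp only [← Finset.sum_mul]
  ring

theorem contract_one (R : Tensor4 n) : contract R 1 = ric R := by
  ext i k
  simp [contract, ric, one_apply]

theorem contract_add (R : Tensor4 n) (A B : Matrix (Fin n) (Fin n) ℝ) :
    contract R (A + B) = contract R A + contract R B := by
  ext i k
  simp only [contract, of_apply, Matrix.add_apply, mul_add, Finset.sum_add_distrib]

theorem contract_smul (R : Tensor4 n) (c : ℝ) (A : Matrix (Fin n) (Fin n) ℝ) :
    contract R (c • A) = c • contract R A := by
  ext i k
  simp only [contract, of_apply, Matrix.smul_apply, smul_eq_mul, Finset.mul_sum]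
  exact Finset.sum_congr rfl fun p _ => Finset.sum_congr rfl fun q _ => by ring

theorem ric_add (R T : Tensor4 n) : ric (R + T) = ric R + ric T := by
  ext i k
  simp only [ric, of_apply, Matrix.add_apply, Pi.add_apply, Finset.sum_add_distrib]

theorem ric_smul (c : ℝ) (R : Tensor4 n) : ric (c • R) = c • ric R := by
  ext i k
  simp only [ric, of_apply, Matrix.smul_apply, Pi.smul_apply, smul_eq_mul, Finset.mul_sum]

/-- The Bianchi identity gives X = 2Y for the two quadratic contractions that come from the first
and last terms of Q, so these cancel. -/
theorem ric_QTensor {R : Tensor4 n} (hR : R ∈ CurvOp n) :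
    ric (QTensor R) = (2 : ℝ) • contract R (ric R) := by
  ext i k
  have e : ∀ i p a b, R i p a b = R i a p b - R i b p a := by
    intro i p a b
    have b1 := hR.2.2 i p a b
    have b2 := antisymm_right hR i a p b
    linarith
  let X := ∑ p, ∑ a, ∑ b, R i p a b * R k p a b
  let Y := ∑ p, ∑ a, ∑ b, R i a p b * R k b p a
  have hX : X = 2 * Y := by
    have h1 : X = ∑ p, ∑ a, ∑ b, R i a p b * R k a p b - Y -
        ∑ p, ∑ a, ∑ b, R i b p a * R k a p b + ∑ p, ∑ a, ∑ b, R i b p a * R k b p a := by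
      simp only [X, Y, ← Finset.sum_sub_distrib, ← Finset.sum_add_distrib]
      refine Finset.sum_congr rfl fun p _ => Finset.sum_congr rfl fun a _ =>
        Finset.sum_congr rfl fun b _ => ?_
      rw [e i p a b, e k p a b]
      ring
    have h2 : ∑ p, ∑ a, ∑ b, R i a p b * R k a p b = X := Finset.sum_comm
    have h3 : ∑ p, ∑ a, ∑ b, R i b p a * R k a p b = Y :=
      Finset.sum_congr rfl fun p _ => Finset.sum_comm
    have h4 : ∑ p, ∑ a, ∑ b, R i b p a * R k b p a = X := by
      rw [← h2]
      exact Finset.sum_congr rfl fun p _ => Finset.sum_comm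
    rw [h2, h3, h4] at h1
    linarith
  have h1 : ric (QTensor R) i k = X + 2 * (∑ p, ∑ a, ∑ b, R i a k b * R p a p b) - 2 * Y := by
    simp only [ric, of_apply, QTensor, X, Y, Finset.mul_sum, ← Finset.sum_sub_distrib,
      ← Finset.sum_add_distrib]
    refine Finset.sum_congr rfl fun p _ => Finset.sum_congr rfl fun a _ =>
        Finset.sum_congr rfl fun b _ => ?_
    rw [hR.2.1 k b p a]
    ring
  have h2 : ∑ p, ∑ a, ∑ b, R i a k b * R p a p b = contract R (ric R) i k := by
    simp only [contract, ric, of_apply, Finset.mul_sum]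
    rw [Finset.sum_comm]
    refine Finset.sum_congr rfl fun a _ => ?_
    rw [Finset.sum_comm]
    refine Finset.sum_congr rfl fun b _ => Finset.sum_congr rfl fun p _ => ?_
    rw [swap_both hR p a p b]
  rw [h1, h2, hX, Matrix.smul_apply, smul_eq_mul]
  ring

theorem trace_contract {R : Tensor4 n} (hR : R ∈ CurvOp n) {A : Matrix (Fin n) (Fin n) ℝ}
    (hA : A.IsSymm) : (contract R A).trace = (ric R * A).trace := by
  simp only [contract, trace, diag_apply, of_apply, mul_apply, ric, Finset.sum_mul]
  rw [Finset.sum_comm]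
  refine Finset.sum_congr rfl fun p _ => ?_
  rw [Finset.sum_comm]
  refine Finset.sum_congr rfl fun q _ => Finset.sum_congr rfl fun i _ => ?_
  rw [swap_both hR p i q i, hA.apply p q]

/-- The difference between the Hamilton ODE and its pullback under `ℓ_{a,b}`. -/
noncomputable def reaction (a b : ℝ) (R : Tensor4 n) : Tensor4 n :=
  (2 * a) • kn (ric R) (ric R) + (2 * b ^ 2) • kn (ric₀ R * ric₀ R) 1 +
    (b ^ 2 * (2 - 4 * b - n * (n - 2) * b ^ 2) / (n * (1 + 2 * (n - 1) * a)) *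
      (ric₀ R * ric₀ R).trace) • kn 1 1

theorem kn_add_left (A A' B : Matrix (Fin n) (Fin n) ℝ) : kn (A + A') B = kn A B + kn A' B := by
  funext i j k l; simp only [kn, Pi.add_apply, Matrix.add_apply]; ring

theorem kn_smul_left (c : ℝ) (A B : Matrix (Fin n) (Fin n) ℝ) : kn (c • A) B = c • kn A B := by
  funext i j k l; simp only [kn, Pi.smul_apply, Matrix.smul_apply, smul_eq_mul]; ring

theorem trace_ric₀ (hn : n ≠ 0) (R : Tensor4 n) : (ric₀ R).trace = 0 := by
  have : (n : ℝ) ≠ 0 := by exact_mod_cast hn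
  rw [ric₀, trace_sub, trace_smul, trace_one, Fintype.card_fin, smul_eq_mul,
    div_mul_cancel₀ _ this, scal, sub_self]

theorem ric_eq_ric₀_add (R : Tensor4 n) : ric R = ric₀ R + (scal R / n) • 1 := by
  rw [ric₀, sub_add_cancel]

theorem QTensor_add_kn_one {R : Tensor4 n} (hR : R ∈ CurvOp n) {A : Matrix (Fin n) (Fin n) ℝ}
    (hA : A.IsSymm) : QTensor (R + kn A 1) = QTensor R + (2 : ℝ) • kn (ric R) A +
      (2 : ℝ) • kn (contract R A) 1 + kn (((n : ℝ) - 2) • A + A.trace • 1) A +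
      kn (A.trace • A - (2 : ℝ) • (A * A) + (A * A).trace • 1) 1 := by
  have hr : ric (kn A 1) = ((n : ℝ) - 2) • A + A.trace • 1 := by
    rw [ric_kn, trace_one, Fintype.card_fin, mul_one, one_mul]
    module
  -- The cross-term formula with R itself equal to A ⊙ id yields Q(A ⊙ id), since polarisation on
  -- the diagonal doubles Q.
  have h := crossQ_kn_one (kn_mem hA Matrix.isSymm_one) hA
  rw [crossQ_self, contract_kn_one hA, hr] at h
  rw [QTensor_add, crossQ_kn_one hR hA]
  funext i j k l
  have h' := congrFun (congrFun (congrFun (congrFun h i) j) k) l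
  simp only [Pi.smul_apply, Pi.add_apply, nsmul_eq_mul, smul_eq_mul] at h' ⊢
  push_cast at h'
  linarith

/-- Both sides reduce to expressions in Q(R), r = Ric₀, r², scal, the contraction of R with r, and
id. The coefficient of r ⊙ r is 2b + (n−2)b² on the left and 2a on the right, which explains `hab`.
-/
theorem QTensor_ellTensor (hn : n ≠ 0) {a b : ℝ} (hab : 2 * a = 2 * b + ((n : ℝ) - 2) * b ^ 2)
    (ha : 1 + 2 * ((n : ℝ) - 1) * a ≠ 0) {R : Tensor4 n} (hR : R ∈ CurvOp n) :
    QTensor (ellTensor a b R) = ellTensor a b (QTensor R + reaction a b R) := by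
  have hm : (n : ℝ) ≠ 0 := by exact_mod_cast hn
  have hr0 := trace_ric₀ hn R
  have hric := ric_eq_ric₀_add R
  have hrs := ric₀_isSymm hR
  have hell : ellTensor a b R = R + kn (b • ric₀ R + (a * (scal R / n)) • 1) 1 := by
    rw [ellTensor, kn_add_left, kn_smul_left, kn_smul_left, ← add_assoc]
    congr 2
    ring
  have hAs : (b • ric₀ R + (a * (scal R / n)) • (1 : Matrix (Fin n) (Fin n) ℝ)).IsSymm :=
    (hrs.smul _).add (Matrix.isSymm_one.smul _)
  obtain ⟨ν, hν⟩ : ∃ ν, (ric₀ R * ric₀ R).trace = n * ν :=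
    ⟨(ric₀ R * ric₀ R).trace / n, by field_simp⟩
  obtain ⟨g, hg⟩ : ∃ g, g = b ^ 2 * (2 - 4 * b - n * (n - 2) * b ^ 2) /
    (n * (1 + 2 * (n - 1) * a)) * (n * ν) := ⟨_, rfl⟩
  -- The only denominator that involves a is cleared here; this relation fixes the id ⊙ id
  -- coefficient in the final comparison.
  have hg' : g * (1 + 2 * (n - 1) * a) = ν * b ^ 2 * (2 - 4 * b - n * (n - 2) * b ^ 2) := by
    rw [hg]; field_simp
  have hre : reaction a b R = (2 * a) • kn (ric R) (ric R) + (2 * b ^ 2) • kn (ric₀ R * ric₀ R) 1 +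
      g • kn 1 1 := by rw [reaction, hν, hg]
  have hconR := contract_one R
  have htrK := trace_contract hR hrs
  have hQR := ric_QTensor hR
  have hT : ellTensor a b (QTensor R + reaction a b R) = QTensor R + reaction a b R +
      b • kn (ric₀ (QTensor R + reaction a b R)) 1 +
      (a / n * scal (QTensor R + reaction a b R)) • kn 1 1 := rfl
  have hT0 : ric₀ (QTensor R + reaction a b R) = ric (QTensor R) + ric (reaction a b R) -
      (scal (QTensor R + reaction a b R) / n) • 1 := by rw [ric₀, ric_add]
  have hTs : scal (QTensor R + reaction a b R) =
      (ric (QTensor R) + ric (reaction a b R)).trace := by rw [scal, ric_add]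
  rw [hell, QTensor_add_kn_one hR hAs, hT, hT0, hTs]
  rw [hre, hQR]
  rw [hric] at htrK hconR ⊢
  generalize ric₀ R = r at *
  generalize scal R / n = s at *
  simp only [ric_add, ric_smul, ric_kn, contract_add, contract_smul, hconR]
  simp only [add_mul, mul_add, Matrix.smul_mul, Matrix.mul_smul, mul_one, one_mul, trace_add,
    trace_sub, trace_smul, trace_one, Fintype.card_fin, hr0, hν, smul_eq_mul] at htrK ⊢
  rw [htrK]
  have ha' : a = b + ((n : ℝ) - 2) * b ^ 2 / 2 := by linarith
  funext i j k l
  simp only [kn, Pi.add_apply, Pi.smul_apply, smul_eq_mul, Matrix.add_apply, Matrix.sub_apply,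
    Matrix.smul_apply]
  generalize (1 : Matrix (Fin n) (Fin n) ℝ) = I at *
  generalize contract R r = K at *
  generalize r * r = P at *
  clear hab ha
  subst ha'
  field_simp
  linear_combination (-4 * (n : ℝ) * (I i k * I j l - I i l * I j k - I j k * I i l + I j l * I i k)) * hg'

/-! ### Compactness and the maximum principle. -/

theorem sum_normSq_eq_zero {M : Matrix (Fin n) (Fin n) ℂ}
    (h : ∑ i, ∑ j, Complex.normSq (M i j) = 0) : M = 0 := by
  ext i j
  have h1 := (Finset.sum_eq_zero_iff_of_nonneg fun i _ => Finset.sum_nonneg fun j _ =>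
    Complex.normSq_nonneg (M i j)).1 h i (Finset.mem_univ i)
  have h2 := (Finset.sum_eq_zero_iff_of_nonneg fun j _ =>
    Complex.normSq_nonneg (M i j)).1 h1 j (Finset.mem_univ j)
  simpa using h2

/-- The decomposable bivectors of norm one. -/
def unitDecomposable (n : ℕ) : Set (Matrix (Fin n) (Fin n) ℂ) :=
  {M | IsDecomposable M ∧ ∑ i, ∑ j, Complex.normSq (M i j) = 1}

theorem norm_le_one_of_mem {M : Matrix (Fin n) (Fin n) ℂ} (hM : M ∈ unitDecomposable n)
    (i j : Fin n) : ‖M i j‖ ≤ 1 := by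
  have h1 : Complex.normSq (M i j) ≤ 1 := by
    rw [← hM.2]
    refine (Finset.single_le_sum (f := fun j => Complex.normSq (M i j))
      (fun j _ => Complex.normSq_nonneg _) (Finset.mem_univ j)).trans ?_
    exact Finset.single_le_sum (f := fun i => ∑ j, Complex.normSq (M i j))
      (fun i _ => Finset.sum_nonneg fun j _ => Complex.normSq_nonneg _) (Finset.mem_univ i)
  rw [Complex.normSq_eq_norm_sq] at h1
  nlinarith [norm_nonneg (M i j)]

theorem isCompact_unitDecomposable : IsCompact (unitDecomposable n) := by
  have h : IsCompact {M : Fin n → Fin n → ℂ | ((∀ i j, M j i = -M i j) ∧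
      ∀ i j k l, M i j * M k l - M i k * M j l + M i l * M j k = 0) ∧
      ∑ i, ∑ j, Complex.normSq (M i j) = 1} := by
    refine Metric.isCompact_of_isClosed_isBounded ?_ ?_
    · refine IsClosed.and (IsClosed.and ?_ ?_) ?_
      · simp only [Set.ofPred_forall]
        exact isClosed_iInter fun i => isClosed_iInter fun j =>
          isClosed_eq (by fun_prop) (by fun_prop)
      · simp only [Set.ofPred_forall]
        exact isClosed_iInter fun i => isClosed_iInter fun j =>
          isClosed_iInter fun k => isClosed_iInter fun l =>
          isClosed_eq (by fun_prop) (by fun_prop)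
      · refine isClosed_eq ?_ continuous_const
        refine continuous_finsetSum _ fun i _ => continuous_finsetSum _ fun j _ => ?_
        exact Complex.continuous_normSq.comp (by fun_prop)
    · refine (Metric.isBounded_closedBall (x := (0 : Fin n → Fin n → ℂ)) (r := 1)).subset ?_
      intro M hM
      rw [mem_closedBall_zero_iff, pi_norm_le_iff_of_nonneg zero_le_one]
      intro i
      rw [pi_norm_le_iff_of_nonneg zero_le_one]
      exact fun j => norm_le_one_of_mem (M := M)
        ⟨⟨by ext i j; exact hM.1.1 i j, hM.1.2⟩, hM.2⟩ i j
  have heq : unitDecomposable n = {M : Fin n → Fin n → ℂ | ((∀ i j, M j i = -M i j) ∧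
      ∀ i j k l, M i j * M k l - M i k * M j l + M i l * M j k = 0) ∧
      ∑ i, ∑ j, Complex.normSq (M i j) = 1} := by
    ext M
    exact and_congr (and_congr ⟨fun h i j => congrFun (congrFun h i) j,
      fun h => by ext i j; exact h i j⟩ Iff.rfl) Iff.rfl
  rw [heq]
  exact h

theorem isoForm_nonneg_of_unit {R : Tensor4 n} (h : ∀ M ∈ unitDecomposable n, 0 ≤ isoForm R M)
    {M : Matrix (Fin n) (Fin n) ℂ} (hM : IsDecomposable M) : 0 ≤ isoForm R M := by
  by_cases h0 : ∑ i, ∑ j, Complex.normSq (M i j) = 0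
  · rw [sum_normSq_eq_zero h0, ← zero_smul ℂ (0 : Matrix (Fin n) (Fin n) ℂ), isoForm_smul]
    simp
  have hpos : 0 < ∑ i, ∑ j, Complex.normSq (M i j) :=
    lt_of_le_of_ne (Finset.sum_nonneg fun i _ => Finset.sum_nonneg fun j _ =>
      Complex.normSq_nonneg _) (Ne.symm h0)
  set c : ℝ := (Real.sqrt (∑ i, ∑ j, Complex.normSq (M i j)))⁻¹ with hc
  have hc0 : 0 < c := inv_pos.2 (Real.sqrt_pos.2 hpos)
  have hc2 : c * c * ∑ i, ∑ j, Complex.normSq (M i j) = 1 := by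
    rw [hc, ← mul_inv, Real.mul_self_sqrt hpos.le, inv_mul_cancel₀ h0]
  have hmem : (c : ℂ) • M ∈ unitDecomposable n := by
    refine ⟨hM.smul _, ?_⟩
    rw [← hc2]
    simp only [Matrix.smul_apply, smul_eq_mul, Complex.normSq_mul, Complex.normSq_ofReal,
      Finset.mul_sum]
  have := h _ hmem
  rw [isoForm_smul] at this
  refine nonneg_of_mul_nonneg_right this (pow_pos (norm_pos_iff.2 ?_) 2)
  exact_mod_cast hc0.ne'

/-- On antisymmetric M the tensor id ⊙ id gives 4|M|². It is the uniformly positive direction used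
for the barrier. -/
theorem re_herm_kn_one_one {M : Matrix (Fin n) (Fin n) ℂ} (hM : M ∈ unitDecomposable n) :
    (herm (kn 1 1) M M).re = 4 := by
  have hM' : ∀ i j, M j i = -M i j := fun i j => congrFun (congrFun hM.1.1 i) j
  have h : herm (kn 1 1) M M = 4 * ∑ i, ∑ j, M i j * star (M i j) := by
    have h4 : ∀ i j : Fin n, ∑ k, ∑ l, ((kn 1 1 i j k l : ℝ) : ℂ) * M i j * star (M k l) =
        4 * (M i j * star (M i j)) := by
      intro i j
      have e : ∀ k l, ((kn 1 1 i j k l : ℝ) : ℂ) * M i j * star (M k l) =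
          4 * ((1 : Matrix (Fin n) (Fin n) ℂ) i k * ((1 : Matrix (Fin n) (Fin n) ℂ) j l *
            (M i j * star (M k l)))) / 2 - 4 * ((1 : Matrix (Fin n) (Fin n) ℂ) i l *
            ((1 : Matrix (Fin n) (Fin n) ℂ) j k * (M i j * star (M k l)))) / 2 := by
        intro k l
        have hδ : ∀ i j, (((1 : Matrix (Fin n) (Fin n) ℝ) i j : ℝ) : ℂ) =
            (1 : Matrix (Fin n) (Fin n) ℂ) i j := fun i j => by
          simp only [one_apply]
          split_ifs <;> simp
        simp only [kn]
        push_cast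
        simp only [hδ]
        ring
      simp only [e, Finset.sum_sub_distrib, ← Finset.sum_div, ← Finset.mul_sum]
      simp only [one_apply, ite_mul, one_mul, zero_mul, Finset.sum_ite_eq, Finset.mem_univ,
        if_true, hM' i j, star_neg]
      ring
    simp only [herm, h4, Finset.mul_sum]
  have h2 : ∑ i, ∑ j, M i j * star (M i j) = ((∑ i, ∑ j, Complex.normSq (M i j) : ℝ) : ℂ) := by
    simp only [Complex.ofReal_sum]
    refine Finset.sum_congr rfl fun i _ => Finset.sum_congr rfl fun j _ => ?_
    rw [Complex.star_def, Complex.mul_conj]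
  rw [h, h2, hM.2]
  simp

/-- Evaluation of the Hermitian form at a fixed bivector, as a linear map. -/
noncomputable def hermLinear (M : Matrix (Fin n) (Fin n) ℂ) : Tensor4 n →ₗ[ℝ] ℝ where
  toFun R := (herm R M M).re
  map_add' R S := by rw [herm_add_tensor, Complex.add_re]
  map_smul' c R := by
    rw [herm_smul_tensor, Complex.re_ofReal_mul, RingHom.id_apply, smul_eq_mul]

theorem isoForm_add_smul_kn (R : Tensor4 n) (c : ℝ) {M : Matrix (Fin n) (Fin n) ℂ}
    (hM : M ∈ unitDecomposable n) : isoForm (R + c • kn 1 1) M = isoForm R M + 4 * c := by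
  rw [isoForm, isoForm, herm_add_tensor, herm_smul_tensor, Complex.add_re, Complex.re_ofReal_mul,
    re_herm_kn_one_one hM]
  ring

theorem abs_re_herm_le (V : Tensor4 n) {M : Matrix (Fin n) (Fin n) ℂ}
    (hM : M ∈ unitDecomposable n) : |(herm V M M).re| ≤ (n : ℝ) ^ 4 * ‖V‖ := by
  refine (Complex.abs_re_le_norm _).trans ?_
  have hV : ∀ i j k l, ‖(V i j k l : ℂ) * M i j * star (M k l)‖ ≤ ‖V‖ := by
    intro i j k l
    rw [norm_mul, norm_mul, norm_star, Complex.norm_real]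
    have h1 : ‖V i j k l‖ ≤ ‖V‖ := (norm_le_pi_norm (V i j k) l).trans <|
      (norm_le_pi_norm (V i j) k).trans <| (norm_le_pi_norm (V i) j).trans (norm_le_pi_norm V i)
    have h2 := norm_le_one_of_mem hM i j
    have h3 := norm_le_one_of_mem hM k l
    calc ‖V i j k l‖ * ‖M i j‖ * ‖M k l‖ ≤ ‖V‖ * 1 * 1 := by gcongr
      _ = ‖V‖ := by ring
  calc ‖herm V M M‖ ≤ ∑ _i : Fin n, ∑ _j : Fin n, ∑ _k : Fin n, ∑ _l : Fin n, ‖V‖ :=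
        norm_sum_le_of_le _ fun i _ => norm_sum_le_of_le _ fun j _ =>
          norm_sum_le_of_le _ fun k _ => norm_sum_le_of_le _ fun l _ => hV i j k l
    _ = (n : ℝ) ^ 4 * ‖V‖ := by
        simp only [Finset.sum_const, Finset.card_univ, Fintype.card_fin, nsmul_eq_mul]
        ring

theorem tendsto_isoForm {S : Type*} {l : Filter S} {u : S → Tensor4 n}
    {v : S → Matrix (Fin n) (Fin n) ℂ} {R : Tensor4 n} {M : Matrix (Fin n) (Fin n) ℂ}
    (hu : Filter.Tendsto u l (nhds R)) (hv : Filter.Tendsto v l (nhds M)) :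
    Filter.Tendsto (fun t => isoForm (u t) (v t)) l (nhds (isoForm R M)) := by
  have hv' : ∀ i j, Filter.Tendsto (fun t => v t i j) l (nhds (M i j)) := fun i j =>
    ((continuous_id.matrix_elem i j).tendsto M).comp hv
  have hu' : ∀ i j k m, Filter.Tendsto (fun t => (u t i j k m : ℂ)) l (nhds (R i j k m : ℂ)) :=
    fun i j k m => (Complex.continuous_ofReal.tendsto _).comp
      (tendsto_pi_nhds.1 (tendsto_pi_nhds.1 (tendsto_pi_nhds.1 (tendsto_pi_nhds.1 hu i) j) k) m)
  simp only [isoForm, trace, diag_apply, mul_apply, transpose_apply, herm]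
  refine Filter.Tendsto.add ((Complex.continuous_re.tendsto _).comp ?_)
    (Filter.Tendsto.const_mul _ (Filter.Tendsto.norm ?_))
  · exact tendsto_finsetSum _ fun i _ => tendsto_finsetSum _ fun j _ =>
      tendsto_finsetSum _ fun k _ => tendsto_finsetSum _ fun m _ =>
      ((hu' i j k m).mul (hv' i j)).mul (hv' k m).star
  · exact tendsto_finsetSum _ fun i _ => tendsto_finsetSum _ fun j _ => (hv' i j).mul (hv' i j)

theorem deriv_nonpos_of_left {f : ℝ → ℝ} {f' t₀ : ℝ} (hf : HasDerivAt f f' t₀)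
    (h0 : f t₀ ≤ 0) {s : ℝ} (hs : s < t₀) (h : ∀ t ∈ Set.Ioo s t₀, 0 < f t) : f' ≤ 0 := by
  have h1 : Filter.Tendsto (slope f t₀) (nhdsWithin t₀ (Set.Iio t₀)) (nhds f') :=
    (hasDerivAt_iff_tendsto_slope.1 hf).mono_left
      (nhdsWithin_mono _ fun x (hx : x < t₀) => hx.ne)
  refine le_of_tendsto h1 ?_
  filter_upwards [Ioo_mem_nhdsLT hs] with t ht
  rw [slope_def_field]
  exact div_nonpos_of_nonneg_of_nonpos (by linarith [h t ht]) (by linarith [ht.2])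

/-- A vector field that points into the cone-like set `{isoForm ≥ 0}` at its boundary leaves that
set invariant. -/
theorem isoForm_nonneg_invariant {X : Tensor4 n → Tensor4 n} (hX : ContDiff ℝ 1 X)
    (hpos : ∀ p ∈ CurvOp n, (∀ M, IsDecomposable M → 0 ≤ isoForm p M) →
      ∀ M, IsDecomposable M → isoForm p M = 0 → 0 ≤ (herm (X p) M M).re)
    {T : ℝ} {R : ℝ → Tensor4 n} (hR : ∀ t ∈ Set.Ico 0 T, R t ∈ CurvOp n)
    (hd : ∀ t ∈ Set.Ico 0 T, HasDerivWithinAt R (X (R t)) (Set.Ico 0 T) t)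
    (h0 : ∀ M, IsDecomposable M → 0 ≤ isoForm (R 0) M) :
    ∀ t ∈ Set.Ico 0 T, ∀ M, IsDecomposable M → 0 ≤ isoForm (R t) M := by
  intro t₁ ht₁ M hM
  refine isoForm_nonneg_of_unit ?_ hM
  clear hM M
  intro M hM
  by_contra! hneg
  have hRc : ContinuousOn R (Set.Icc 0 t₁) := fun t ht =>
    ((hd t ⟨ht.1, ht.2.trans_lt ht₁.2⟩).continuousWithinAt).mono
      fun x hx => ⟨hx.1, hx.2.trans_lt ht₁.2⟩
  obtain ⟨ρ, hρ⟩ := (isCompact_Icc.image_of_continuousOn hRc).isBounded.subset_closedBall 0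
  set I : Tensor4 n := kn 1 1 with hI
  -- The radius leaves room for R t + c I with 0 ≤ c ≤ 1.
  obtain ⟨L, hL⟩ := (hX.contDiffOn (s := Metric.closedBall 0 (ρ + ‖I‖))).exists_lipschitzOnWith
    one_ne_zero (convex_closedBall _ _) (isCompact_closedBall _ _)
  -- The first summand times c bounds the change of X(·)(M, M̄) under a shift by c I; the barrier
  -- must outgrow it.
  set K : ℝ := (n : ℝ) ^ 4 * (L * ‖I‖) + 1 with hK
  have hK0 : 0 < K := by positivity
  -- ε keeps the barrier at most 1 up to t₁, yet too small to compensate the negative value at t₁.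
  obtain ⟨ε, hε, hε1, hε2⟩ : ∃ ε : ℝ, 0 < ε ∧ ε * Real.exp (K * t₁) ≤ 1 ∧
      isoForm (R t₁) M + 4 * (ε * Real.exp (K * t₁)) ≤ 0 := by
    refine ⟨min 1 (-isoForm (R t₁) M / 4) * Real.exp (-(K * t₁)), ?_, ?_, ?_⟩
    · have : 0 < min 1 (-isoForm (R t₁) M / 4) := lt_min one_pos (by linarith)
      positivity
    · rw [mul_assoc, ← Real.exp_add, neg_add_cancel, Real.exp_zero, mul_one]
      exact min_le_left _ _
    · rw [mul_assoc, ← Real.exp_add, neg_add_cancel, Real.exp_zero, mul_one]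
      linarith [min_le_right 1 (-isoForm (R t₁) M / 4)]
  let G : ℝ × Matrix (Fin n) (Fin n) ℂ → ℝ := fun p =>
    isoForm (R p.1) p.2 + 4 * (ε * Real.exp (K * p.1))
  let D : Set (ℝ × Matrix (Fin n) (Fin n) ℂ) := Set.Icc 0 t₁ ×ˢ unitDecomposable n
  have hDc : IsCompact D := isCompact_Icc.prod isCompact_unitDecomposable
  have hGc : ContinuousOn G D := by
    refine ContinuousOn.add ?_ (by fun_prop)
    have hR' : ContinuousOn (fun p : ℝ × Matrix (Fin n) (Fin n) ℂ => R p.1) D :=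
      hRc.comp continuousOn_fst fun p hp => hp.1
    exact fun p hp => tendsto_isoForm (hR' p hp) continuousWithinAt_snd
  have hZc : IsCompact (Prod.fst '' (D ∩ G ⁻¹' Set.Iic 0)) := by
    refine IsCompact.image ?_ continuous_fst
    exact hDc.of_isClosed_subset (hGc.preimage_isClosed_of_isClosed hDc.isClosed isClosed_Iic)
      Set.inter_subset_left
  obtain ⟨t₀, ⟨⟨t', M₀⟩, ⟨⟨ht₀, hM₀⟩, hG₀⟩, rfl⟩, hleast⟩ := hZc.exists_isLeast
    ⟨t₁, (t₁, M), ⟨⟨⟨ht₁.1, le_rfl⟩, hM⟩, hε2⟩, rfl⟩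
  simp only at ht₀ hM₀ hleast
  have hG₀' : isoForm (R t') M₀ + 4 * (ε * Real.exp (K * t')) ≤ 0 := hG₀
  have hbefore : ∀ t ∈ Set.Ico 0 t', ∀ N ∈ unitDecomposable n,
      0 < isoForm (R t) N + 4 * (ε * Real.exp (K * t)) := by
    intro t ht N hN
    by_contra! hcon
    have := hleast ⟨(t, N), ⟨⟨⟨ht.1, ht.2.le.trans ht₀.2⟩, hN⟩, hcon⟩, rfl⟩
    exact absurd ht.2 (not_lt.2 this)
  have ht₀pos : 0 < t' := by
    rcases ht₀.1.lt_or_eq with h | h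
    · exact h
    · exfalso
      rw [← h] at hG₀'
      have h1 := h0 M₀ hM₀.1
      have h2 : 0 < ε * Real.exp (K * 0) := by positivity
      linarith
  have hmem : t' ∈ Set.Ico 0 T := ⟨ht₀.1, ht₀.2.trans_lt ht₁.2⟩
  have hder : HasDerivAt R (X (R t')) t' :=
    (hd t' hmem).hasDerivAt (Ico_mem_nhds ht₀pos hmem.2)
  set c : ℝ := ε * Real.exp (K * t') with hc
  have hc0 : 0 < c := by positivity
  have hc1 : c ≤ 1 := by
    refine le_trans ?_ hε1
    rw [hc]
    gcongr
    exact ht₀.2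
  have hat : ∀ N ∈ unitDecomposable n, 0 ≤ isoForm (R t') N + 4 * c := by
    intro N hN
    have hcont : ContinuousAt (fun t => isoForm (R t) N + 4 * (ε * Real.exp (K * t))) t' := by
      refine ContinuousAt.add ?_ (by fun_prop)
      exact tendsto_isoForm hder.continuousAt tendsto_const_nhds
    refine ge_of_tendsto (hcont.tendsto.mono_left
      (nhdsWithin_le_nhds (s := Set.Iio t'))) ?_
    filter_upwards [Ioo_mem_nhdsLT ht₀pos] with t ht
    exact (hbefore t ⟨ht.1.le, ht.2⟩ N hN).le
  have hp : ∀ N, IsDecomposable N → 0 ≤ isoForm (R t' + c • I) N := fun N hN =>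
    isoForm_nonneg_of_unit (fun N hN => by rw [isoForm_add_smul_kn _ _ hN]; exact hat N hN) hN
  have hpz : isoForm (R t' + c • I) M₀ = 0 :=
    le_antisymm (by rw [isoForm_add_smul_kn _ _ hM₀]; exact hG₀') (hp M₀ hM₀.1)
  have hpC : R t' + c • I ∈ CurvOp n := (CurvOp n).add_mem (hR t' hmem)
    ((CurvOp n).smul_mem _ (kn_mem Matrix.isSymm_one Matrix.isSymm_one))
  -- The boundary hypothesis applies to the shifted tensor, which satisfies all inequalities with
  -- equality at M₀; R t' itself may violate them.
  have hXp := hpos _ hpC hp M₀ hM₀.1 hpz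
  have hRt : ‖R t'‖ ≤ ρ := by
    simpa using hρ ⟨t', ht₀, rfl⟩
  have hcI : ‖c • I‖ ≤ ‖I‖ := by
    rw [norm_smul, Real.norm_of_nonneg hc0.le]
    exact mul_le_of_le_one_left (norm_nonneg _) hc1
  have hlip : ‖X (R t' + c • I) - X (R t')‖ ≤ L * (c * ‖I‖) := by
    have := hL.norm_sub_le (x := R t' + c • I) (y := R t')
      (by
        rw [mem_closedBall_zero_iff]
        exact (norm_add_le _ _).trans (add_le_add hRt hcI))
      (by
        rw [mem_closedBall_zero_iff]
        exact hRt.trans (le_add_of_nonneg_right (norm_nonneg _)))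
    rwa [add_sub_cancel_left, norm_smul, Real.norm_of_nonneg hc0.le] at this
  have hbound := abs_re_herm_le (X (R t' + c • I) - X (R t')) hM₀
  have hsub : (herm (X (R t' + c • I) - X (R t')) M₀ M₀).re =
      (herm (X (R t' + c • I)) M₀ M₀).re - (herm (X (R t')) M₀ M₀).re :=
    map_sub (hermLinear M₀) _ _
  have hderiv : HasDerivAt (fun t => isoForm (R t) M₀ + 4 * (ε * Real.exp (K * t)))
      ((herm (X (R t')) M₀ M₀).re + 4 * (ε * (Real.exp (K * t') * K))) t' := by
    refine HasDerivAt.add ?_ ?_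
    · have h1 := ((hermLinear M₀).toContinuousLinearMap.hasFDerivAt (x := R t')).comp_hasDerivAt t'
        hder
      exact h1.add_const (2 * ‖trace (M₀ * M₀ᵀ)‖)
    · have h2 : HasDerivAt (fun t : ℝ => K * t) K t' := by
        simpa using (hasDerivAt_id t').const_mul K
      exact (h2.exp.const_mul ε).const_mul 4
  have hle := deriv_nonpos_of_left hderiv hG₀' ht₀pos
    fun t ht => hbefore t ⟨ht.1.le, ht.2⟩ M₀ hM₀
  rw [hsub] at hbound
  have h5 := (abs_le.1 hbound).2
  have h6 : (n : ℝ) ^ 4 * ‖X (R t' + c • I) - X (R t')‖ ≤ (n : ℝ) ^ 4 * (L * (c * ‖I‖)) := by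
    gcongr
  have h7 : ε * (Real.exp (K * t') * K) = c * K := by rw [hc]; ring
  rw [h7] at hle
  have h8 : (n : ℝ) ^ 4 * (L * (c * ‖I‖)) = c * (K - 1) := by rw [hK]; ring
  have h9 : 0 < c * K := mul_pos hc0 hK0
  -- The derivative at first contact is at least −c(K − 1) + 4cK > 0, contradicting `hle`.
  nlinarith

/-! ### Pullback under ℓ_{a,b} and conclusion. -/

theorem contDiff_QTensor : ContDiff ℝ 1 (QTensor : Tensor4 n → Tensor4 n) := by
  unfold QTensor
  fun_prop

theorem contDiff_reaction (a b : ℝ) : ContDiff ℝ 1 (reaction a b : Tensor4 n → Tensor4 n) := by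
  have h : (reaction a b : Tensor4 n → Tensor4 n) = fun R i j k l => reaction a b R i j k l := rfl
  rw [h]
  refine contDiff_pi' fun i => contDiff_pi' fun j => contDiff_pi' fun k => contDiff_pi' fun l => ?_
  simp only [reaction, kn, Pi.add_apply, Pi.smul_apply, smul_eq_mul, ric₀, ric, scal, trace,
    diag_apply, of_apply, mul_apply, Matrix.sub_apply, Matrix.smul_apply]
  fun_prop

theorem re_herm_reaction_nonneg (hn : 3 ≤ n) {a b : ℝ} (ha : 0 ≤ a)
    (hb : 0 ≤ 2 - 4 * b - n * (n - 2) * b ^ 2) {R : Tensor4 n} (hR : R ∈ CurvOp n)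
    (hE : ∀ M, IsDecomposable M → 0 ≤ isoForm R M) {M : Matrix (Fin n) (Fin n) ℂ}
    (hM : Mᵀ = -M) : 0 ≤ (herm (reaction a b R) M M).re := by
  have hm : (3 : ℝ) ≤ n := by exact_mod_cast hn
  have hric := ric_posSemidef hn hR hE
  have hsq : (ric₀ R * ric₀ R).PosSemidef := by
    have := posSemidef_conjTranspose_mul_self (ric₀ R)
    rwa [conjTranspose_eq_transpose_of_trivial, ric₀_isSymm hR] at this
  have hone : (1 : Matrix (Fin n) (Fin n) ℝ).PosSemidef := PosSemidef.one
  rw [reaction, herm_add_tensor, herm_add_tensor, herm_smul_tensor, herm_smul_tensor,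
    herm_smul_tensor, Complex.add_re, Complex.add_re, Complex.re_ofReal_mul,
    Complex.re_ofReal_mul, Complex.re_ofReal_mul]
  have h1 := re_herm_kn_nonneg hric hric hM
  have h2 := re_herm_kn_nonneg hsq hone hM
  have h3 := re_herm_kn_nonneg hone hone hM
  have h4 := hsq.trace_nonneg
  have h5 : 0 < n * (1 + 2 * ((n : ℝ) - 1) * a) := by
    have : 0 ≤ ((n : ℝ) - 1) * a := mul_nonneg (by linarith) ha
    exact mul_pos (by linarith) (by linarith)
  have h6 : 0 ≤ b ^ 2 * (2 - 4 * b - n * (n - 2) * b ^ 2) / (n * (1 + 2 * ((n : ℝ) - 1) * a)) :=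
    div_nonneg (mul_nonneg (sq_nonneg _) hb) h5.le
  refine add_nonneg (add_nonneg (mul_nonneg (by linarith) h1) (mul_nonneg (by positivity) h2))
    (mul_nonneg (mul_nonneg h6 h4) h3)

/-- `ℓ_{a,b}` as a linear map on tensors. -/
noncomputable def ellLinear (a b : ℝ) : Tensor4 n →ₗ[ℝ] Tensor4 n where
  toFun := ellTensor a b
  map_add' R T := by
    have h1 : scal (R + T) = scal R + scal T := by rw [scal, ric_add, trace_add, scal, scal]
    have h2 : ric₀ (R + T) = ric₀ R + ric₀ T := by
      rw [ric₀, ric_add, h1, ric₀, ric₀, add_div, add_smul]; abel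
    rw [ellTensor, h1, h2, kn_add_left, ellTensor, ellTensor]
    module
  map_smul' c R := by
    have h1 : scal (c • R) = c * scal R := by
      rw [scal, ric_smul, trace_smul, scal, smul_eq_mul]
    have h2 : ric₀ (c • R) = c • ric₀ R := by
      rw [ric₀, ric_smul, h1, ric₀, smul_sub, smul_smul, mul_div_assoc]
    rw [ellTensor, h1, h2, kn_smul_left, ellTensor, RingHom.id_apply]
    module

/-- ℓ_{a,b} multiplies Ric₀ by 1 + (n−2)b and scal by 1 + 2(n−1)a, so the corrections cancel under
the two stated conditions. -/
theorem ellTensor_ellTensor (hn : n ≠ 0) {a b a' b' : ℝ}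
    (hb : b + b' * (1 + (n - 2) * b) = 0) (ha : a + a' * (1 + 2 * (n - 1) * a) = 0)
    (R : Tensor4 n) : ellTensor a' b' (ellTensor a b R) = R := by
  have hm : (n : ℝ) ≠ 0 := by exact_mod_cast hn
  have hr0 := trace_ric₀ hn R
  have hric : ric (ellTensor a b R) = ric R + b • (((n : ℝ) - 2) • ric₀ R) +
      (a / n * scal R) • ((2 * (n : ℝ) - 2) • (1 : Matrix (Fin n) (Fin n) ℝ)) := by
    rw [ellTensor, ric_add, ric_add, ric_smul, ric_smul, ric_kn, ric_kn, hr0, trace_one,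
      Fintype.card_fin, mul_one, one_mul, mul_one]
    module
  have hscal : scal (ellTensor a b R) = (1 + 2 * (n - 1) * a) * scal R := by
    rw [scal, hric, trace_add, trace_add, trace_smul, trace_smul, trace_smul, trace_smul, hr0,
      trace_one, Fintype.card_fin, ← scal]
    simp only [smul_eq_mul]
    field_simp
    ring
  have hric₀ : ric₀ (ellTensor a b R) = (1 + (n - 2) * b) • ric₀ R := by
    rw [ric₀, hric, hscal]
    have h1 : (1 + 2 * ((n : ℝ) - 1) * a) * scal R / n =
      scal R / n + a / n * scal R * (2 * n - 2) := by ring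
    rw [h1, ric_eq_ric₀_add R]
    module
  rw [ellTensor, hric₀, hscal, kn_smul_left, ellTensor]
  have h1 : b' * (1 + (n - 2) * b) = -b := by linarith
  have h2 : a' / n * ((1 + 2 * (n - 1) * a) * scal R) = -(a / n * scal R) := by
    field_simp
    linear_combination scal R * ha
  rw [smul_smul, h1, h2]
  module

/-- Squaring bm + 2 ≤ √(2m+4) gives m(2 − 4b − mb²) ≥ 0; with m = n(n−2), the upper endpoint for b
is the positive root of this quadratic. -/
theorem le_of_mem_Ioc {m b : ℝ} (hm : 0 < m) (hb0 : 0 < b)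
    (hb : b ≤ (Real.sqrt (2 * m + 4) - 2) / m) : 0 ≤ 2 - 4 * b - m * b ^ 2 := by
  rw [le_div_iff₀ hm] at hb
  have h1 : b * m + 2 ≤ Real.sqrt (2 * m + 4) := by linarith
  have h2 := (Real.le_sqrt (by positivity) (by positivity)).1 h1
  have h3 : 0 ≤ m * (2 - 4 * b - m * b ^ 2) := by nlinarith
  exact nonneg_of_mul_nonneg_right h3 hm

/-- `ℓ_{a,b}(E)` is invariant under the Hamilton ODE. -/
theorem invariantUnderODE_ell_image (n : ℕ) (hn : 3 ≤ n) (a b : ℝ)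
    (hb : b ∈ Set.Ioc (0 : ℝ)
      ((Real.sqrt (2 * (n : ℝ) * ((n : ℝ) - 2) + 4) - 2) / ((n : ℝ) * ((n : ℝ) - 2))))
    (hab : 2 * a = 2 * b + ((n : ℝ) - 2) * b ^ 2) :
    InvariantUnderODE (Q (n := n))
      (ell a b '' E n) := by
  have hm : (3 : ℝ) ≤ n := by exact_mod_cast hn
  have hn0 : n ≠ 0 := by omega
  have hb0 := hb.1
  have ha0 : 0 < a := by
    have : 0 ≤ ((n : ℝ) - 2) * b ^ 2 := mul_nonneg (by linarith) (sq_nonneg _)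
    linarith
  have hbq : 0 ≤ 2 - 4 * b - n * ((n : ℝ) - 2) * b ^ 2 := by
    refine le_of_mem_Ioc (mul_pos (by linarith) (by linarith)) hb0 ?_
    have := hb.2
    rwa [mul_assoc] at this
  have hf : 0 < 1 + ((n : ℝ) - 2) * b := by
    have : 0 ≤ ((n : ℝ) - 2) * b := mul_nonneg (by linarith) hb0.le
    linarith
  have hh : 0 < 1 + 2 * ((n : ℝ) - 1) * a := by
    have : 0 ≤ ((n : ℝ) - 1) * a := mul_nonneg (by linarith) ha0.le
    linarith
  obtain ⟨b', hb'⟩ : ∃ b', b' = -b / (1 + ((n : ℝ) - 2) * b) := ⟨_, rfl⟩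
  obtain ⟨a', ha'⟩ : ∃ a', a' = -a / (1 + 2 * ((n : ℝ) - 1) * a) := ⟨_, rfl⟩
  have hb1 : b' * (1 + ((n : ℝ) - 2) * b) = -b := by rw [hb', div_mul_cancel₀ _ hf.ne']
  have ha1 : a' * (1 + 2 * ((n : ℝ) - 1) * a) = -a := by rw [ha', div_mul_cancel₀ _ hh.ne']
  have hinv : ∀ R : Tensor4 n, ellTensor a' b' (ellTensor a b R) = R :=
    ellTensor_ellTensor hn0 (by linarith) (by linarith)
  have hinv' : ∀ R : Tensor4 n, ellTensor a b (ellTensor a' b' R) = R :=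
    ellTensor_ellTensor hn0 (by linear_combination hb1) (by linear_combination ha1)
  intro T S hS hS0 t ht
  obtain ⟨R₀, hR₀, hR₀S⟩ := hS0
  -- The pullback ℓ⁻¹(S t), which solves the equation with the additional reaction term.
  let R : ℝ → Tensor4 n := fun t => ellTensor a' b' (S t).1
  have hR : ∀ t, R t ∈ CurvOp n := fun t => ellTensor_mem a' b' (S t).2
  have hSR : ∀ t, (S t).1 = ellTensor a b (R t) := fun t => (hinv' _).symm
  have hd : ∀ t ∈ Set.Ico 0 T, HasDerivWithinAt R (QTensor (R t) + reaction a b (R t))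
      (Set.Ico 0 T) t := by
    intro t ht
    have h1 : HasDerivWithinAt (fun t => (S t).1) (QTensor (S t).1) (Set.Ico 0 T) t :=
      ((CurvOp n).subtypeL.hasFDerivAt (x := S t)).comp_hasDerivWithinAt t (hS t ht)
    have h2 : HasDerivWithinAt R (ellTensor a' b' (QTensor (S t).1)) (Set.Ico 0 T) t :=
      (ellLinear a' b').toContinuousLinearMap.hasFDerivAt.comp_hasDerivWithinAt
        (f := fun t => (S t).1) t h1
    rwa [hSR t, QTensor_ellTensor hn0 hab hh.ne' (hR t), hinv] at h2
  have hR0 : R 0 = R₀.1 := by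
    change ellTensor a' b' (S 0).1 = R₀.1
    rw [← hR₀S]
    exact hinv _
  have key := isoForm_nonneg_invariant (contDiff_QTensor.add (contDiff_reaction a b))
    (fun p hp hpE M hM hM0 => by
      rw [herm_add_tensor, Complex.add_re]
      exact add_nonneg (re_herm_QTensor_nonneg hp hpE hM hM0)
        (re_herm_reaction_nonneg hn ha0.le hbq hp hpE hM.1))
    (fun t _ => hR t) hd (by rw [hR0]; exact mem_E_iff.1 hR₀) t ht
  exact ⟨⟨R t, hR t⟩, mem_E_iff.2 key, Subtype.ext (hinv' _)⟩

end HamiltonODE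

theorem mainTheorem7 (n : ℕ) (hn : 3 ≤ n) (a b : ℝ)
    (hb : b ∈ Set.Ioc (0 : ℝ)
      ((Real.sqrt (2 * (n : ℝ) * ((n : ℝ) - 2) + 4) - 2) / ((n : ℝ) * ((n : ℝ) - 2))))
    (hab : 2 * a = 2 * b + ((n : ℝ) - 2) * b ^ 2) :
    HamiltonODE.InvariantUnderODE (HamiltonODE.Q (n := n))
      (HamiltonODE.ell a b '' HamiltonODE.E n) :=
  HamiltonODE.invariantUnderODE_ell_image n hn a b hb hab
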